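/- Let $n\ge 2$ and let $w\in\mathfrak S_n$ be fully supported, i.e. $\{w(1),\dots,w(r)\}\ne\{1,\dots,r\}$ for all $1\le r<n$. Elnitsky's polygon $X(w)$ is an equilateral $2n$-gon whose sides are labeled $1,\dots,n,w(n),\dots,w(1)$ in counterclockwise order starting from the top vertex, whose first $n$ sides form half of a centrally symmetric convex $2n$-gon, and in which sides with the same label are parallel; it is oriented so that the path with labels $1,\dots,n$ and the path with labels $w(1),\dots,w(n)$ both descend from the top vertex to the bottom vertex. A rhombic tiling of $X(w)$ is a tiling by rhombi whose edges are congruent and parallel to sides of $X(w)$, and the labels of a tile are the labels of the sides to which its edges are parallel. A tile is a top-perimeter tile if the two sides of $X(w)$ that meet at the top vertex are edges of it, and it is a forced top-perimeter tile for $w$ if it appears as a top-perimeter tile in every rhombic tiling of $X(w)$. Then the following are equivalent: (1) there is a forced top-perimeter tile for $w$; (2) $w(1)$ and $1$ do not appear together in a $321$-pattern of $w$; (3) the first left-to-right minimum of $w$ after $w(1)$ is $1$. Moreover, a forced top-perimeter tile for $w$, when it exists, necessarily has labels $\{1,w(1)\}$. -/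

import Mathlib

namespace Elnitsky

/-! Permutations of `{1, …, n}` are elements of `Equiv.Perm (Fin n)`: the label (or position) `k`
of the one-based convention is the element of `Fin n` with value `k - 1`, so `1` becomes `0` and
`w(1)` becomes `w 0`. The plane is `ℂ`. -/

/-- Full support: `{w(1), …, w(r)} ≠ {1, …, r}` for every `1 ≤ r < n`. -/
def FullySupported {n : ℕ} (w : Equiv.Perm (Fin n)) : Prop :=
  ∀ r : ℕ, 1 ≤ r → r < n → w '' {i : Fin n | (i : ℕ) < r} ≠ {i : Fin n | (i : ℕ) < r}

/-- The entries in positions `i`, `j`, `k` form a `321`-pattern of `w`. -/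
def Is321 {n : ℕ} (w : Equiv.Perm (Fin n)) (i j k : Fin n) : Prop :=
  i < j ∧ j < k ∧ w k < w j ∧ w j < w i

/-- The values `a` and `b` occur together in some `321`-pattern of `w`. -/
def Together321 {n : ℕ} (w : Equiv.Perm (Fin n)) (a b : Fin n) : Prop :=
  ∃ i j k : Fin n, Is321 w i j k ∧
    a ∈ ({w i, w j, w k} : Finset (Fin n)) ∧ b ∈ ({w i, w j, w k} : Finset (Fin n))

/-- The entry in position `i` is a left-to-right minimum of `w`. -/
def IsLRMin {n : ℕ} (w : Equiv.Perm (Fin n)) (i : Fin n) : Prop :=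
  ∀ j : Fin n, j < i → w i < w j

/-- Among the left-to-right minima strictly after the first position, the first one has
value `a`. -/
def FirstLRMinAfterFirstIs {n : ℕ} [NeZero n] (w : Equiv.Perm (Fin n)) (a : Fin n) : Prop :=
  ∃ i : Fin n, IsLeast {j : Fin n | 0 < j ∧ IsLRMin w j} i ∧ w i = a

/-- Admissible directions of the sides `1, …, n` read downwards from the top vertex along the
leftside boundary. They point strictly downwards and turn counterclockwise, so that the sides form
half of a (centrally symmetric) convex `2n`-gon. -/
def IsDirections {n : ℕ} (θ : Fin n → ℝ) : Prop :=
  StrictMono θ ∧ ∀ i, θ i ∈ Set.Ioo Real.pi (2 * Real.pi)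

noncomputable section

/-- The unit vector along the sides with label `i`, directed downwards. -/
def sideVec {n : ℕ} (θ : Fin n → ℝ) (i : Fin n) : ℂ :=
  Complex.exp ((θ i : ℂ) * Complex.I)

/-- The vertex reached from the top vertex (placed at the origin) after following the first `k` of
the sides labeled `σ(1), …, σ(n)` downwards. -/
def pathVertex {n : ℕ} (θ : Fin n → ℝ) (σ : Equiv.Perm (Fin n)) (k : ℕ) : ℂ :=
  ∑ i ∈ Finset.univ.filter (fun i : Fin n => (i : ℕ) < k), sideVec θ (σ i)

/-- The side in position `k` (from the top) of the path with labels `σ(1), …, σ(n)`. -/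
def pathSide {n : ℕ} (θ : Fin n → ℝ) (σ : Equiv.Perm (Fin n)) (k : Fin n) : Set ℂ :=
  segment ℝ (pathVertex θ σ k) (pathVertex θ σ ((k : ℕ) + 1))

/-- The path from the top vertex to the bottom vertex with sides labeled `σ(1), …, σ(n)`. -/
def path {n : ℕ} (θ : Fin n → ℝ) (σ : Equiv.Perm (Fin n)) : Set ℂ :=
  ⋃ k : Fin n, pathSide θ σ k

/-- The leftside boundary, with labels `1, …, n` from top to bottom. -/
def leftBoundary {n : ℕ} (θ : Fin n → ℝ) : Set ℂ := path θ 1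

/-- The rightside boundary, with labels `w(1), …, w(n)` from top to bottom. -/
def rightBoundary {n : ℕ} (θ : Fin n → ℝ) (w : Equiv.Perm (Fin n)) : Set ℂ := path θ w

/-- Elnitsky's polygon `X(w)`, as a closed region of the plane. The leftside and the rightside
boundary both descend strictly from the top vertex to the bottom vertex, so the region that
they bound consists of the horizontal segments from the former to the latter. -/
def polygon {n : ℕ} (θ : Fin n → ℝ) (w : Equiv.Perm (Fin n)) : Set ℂ :=
  {p | ∃ a ∈ leftBoundary θ, ∃ b ∈ rightBoundary θ w,
    a.im = p.im ∧ b.im = p.im ∧ a.re ≤ p.re ∧ p.re ≤ b.re}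

/-- A rhombus whose edges are congruent and parallel to the sides with labels `lo` and `hi`; it is
given by its topmost vertex and its two labels. -/
structure Tile (n : ℕ) where
  top : ℂ
  lo : Fin n
  hi : Fin n
  lo_lt_hi : lo < hi

/-- The (two-element) set of labels of a tile. -/
def Tile.labels {n : ℕ} (t : Tile n) : Finset (Fin n) := {t.lo, t.hi}

/-- The closed rhombus occupied by a tile. -/
def Tile.region {n : ℕ} (θ : Fin n → ℝ) (t : Tile n) : Set ℂ :=
  {p | ∃ a ∈ Set.Icc (0 : ℝ) 1, ∃ b ∈ Set.Icc (0 : ℝ) 1,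
    p = t.top + a • sideVec θ t.lo + b • sideVec θ t.hi}

/-- The four edges of a tile. -/
def Tile.edges {n : ℕ} (θ : Fin n → ℝ) (t : Tile n) : Set (Set ℂ) :=
  {segment ℝ t.top (t.top + sideVec θ t.lo),
   segment ℝ t.top (t.top + sideVec θ t.hi),
   segment ℝ (t.top + sideVec θ t.lo) (t.top + sideVec θ t.lo + sideVec θ t.hi),
   segment ℝ (t.top + sideVec θ t.hi) (t.top + sideVec θ t.lo + sideVec θ t.hi)}

/-- `T` is a rhombic tiling of `X(w)`, that is, an element of `T(w)`: the tiles cover exactly the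
polygon, and distinct tiles have disjoint interiors. -/
def IsRhombicTiling {n : ℕ} (θ : Fin n → ℝ) (w : Equiv.Perm (Fin n)) (T : Finset (Tile n)) :
    Prop :=
  (⋃ t ∈ T, t.region θ) = polygon θ w ∧
  ∀ s ∈ T, ∀ t ∈ T, s ≠ t → Disjoint (interior (s.region θ)) (interior (t.region θ))

/-- A top-perimeter tile shares with the boundary of `X(w)` the two sides on either side of the
top vertex: the first side of the leftside boundary and the first side of the rightside
boundary. -/
def IsTopPerimeter {n : ℕ} [NeZero n] (θ : Fin n → ℝ) (w : Equiv.Perm (Fin n)) (t : Tile n) :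
    Prop :=
  pathSide θ 1 0 ∈ t.edges θ ∧ pathSide θ w 0 ∈ t.edges θ

/-- A forced top-perimeter tile appears as a top-perimeter tile in all rhombic tilings of
`X(w)`. -/
def IsForcedTopPerimeter {n : ℕ} [NeZero n] (θ : Fin n → ℝ) (w : Equiv.Perm (Fin n))
    (t : Tile n) : Prop :=
  ∀ T : Finset (Tile n), IsRhombicTiling θ w T → t ∈ T ∧ IsTopPerimeter θ w t

end

end Elnitsky

/-!
The boundary paths descend, so `X(w)` is the region between the graphs of two functions of the
depth. A tiling has a rightmost tile, and it sits in a corner of the rightside boundary, that is, at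
two adjacent positions forming a descent of `w`; removing it leaves a tiling of the polygon in which
these two sides are exchanged. By induction the labels of every tile form an inversion of `w`. The
tile at the top vertex along the first leftside edge has labels `{1, b}` with `b ≤ w(1)` and `b`
before `1` in `w`, so `b = w(1)` unless `w(1)`, `b`, `1` is a `321`-pattern.

Conversely, let `w(1)`, `b`, `1` be such a pattern. Exchange adjacent descents whose larger value
exceeds `b` as long as there are any, each exchange placing a tile. The value `b` stays before `1`,
so none of these tiles has labels `{1, w(1)}` and lies at the top vertex, and the labels of all
tiles placed afterwards are at most `b`. Full support makes the leftside boundary lie strictly to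
the left of the rightside boundary inside each of its sides, so the tiles cover it.
-/

namespace Elnitsky

open Equiv Filter Set Topology

noncomputable section

variable {n : ℕ} {θ : Fin n → ℝ}

/-! ### Directions -/

/-- The vertical extent of a side with label `i`. -/
def drop (θ : Fin n → ℝ) (i : Fin n) : ℝ := -Real.sin (θ i)

/-- The horizontal displacement per unit of descent along a side with label `i`. -/
def slope (θ : Fin n → ℝ) (i : Fin n) : ℝ := -(Real.cos (θ i) / Real.sin (θ i))

lemma sideVec_im (θ : Fin n → ℝ) (i : Fin n) : (sideVec θ i).im = -drop θ i := by
  simp [sideVec, drop, Complex.exp_ofReal_mul_I_im]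

lemma drop_pos (hθ : IsDirections θ) (i : Fin n) : 0 < drop θ i := by
  have h := Real.sin_pos_of_pos_of_lt_pi (x := θ i - Real.pi)
    (by linarith [(hθ.2 i).1]) (by linarith [(hθ.2 i).2])
  rwa [Real.sin_sub_pi] at h

lemma sideVec_re (hθ : IsDirections θ) (i : Fin n) :
    (sideVec θ i).re = slope θ i * drop θ i := by
  have h : Real.sin (θ i) ≠ 0 := neg_ne_zero.1 (drop_pos hθ i).ne'
  simp only [sideVec, Complex.exp_ofReal_mul_I_re, drop, slope]
  field_simp

lemma slope_strictMono (hθ : IsDirections θ) : StrictMono (slope θ) := by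
  intro i j hij
  have hi : Real.sin (θ i) < 0 := neg_pos.1 (drop_pos hθ i)
  have hj : Real.sin (θ j) < 0 := neg_pos.1 (drop_pos hθ j)
  have hsub : 0 < Real.sin (θ j - θ i) := Real.sin_pos_of_pos_of_lt_pi
    (by linarith [hθ.1 hij]) (by linarith [(hθ.2 i).1, (hθ.2 j).2])
  have hslope : slope θ j - slope θ i =
      Real.sin (θ j - θ i) / (Real.sin (θ i) * Real.sin (θ j)) := by
    rw [Real.sin_sub, slope, slope]
    field_simp [hi.ne, hj.ne]
    ring
  rw [← sub_pos, hslope]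
  exact div_pos hsub (mul_pos_of_neg_of_neg hi hj)

lemma sideVec_injective (hθ : IsDirections θ) : Function.Injective (sideVec θ) := by
  intro i j hij
  have him : drop θ i = drop θ j := by
    rw [← neg_inj, ← sideVec_im, ← sideVec_im, hij]
  have hre : slope θ i * drop θ j = slope θ j * drop θ j := by
    rw [← sideVec_re hθ j, ← hij, sideVec_re hθ, him]
  exact (slope_strictMono hθ).injective (mul_right_cancel₀ (drop_pos hθ j).ne' hre)

/-! ### Paths -/

/-- The depth of the `k`-th vertex of a path below the top vertex. -/
def depth (θ : Fin n → ℝ) (σ : Perm (Fin n)) (k : ℕ) : ℝ := -(pathVertex θ σ k).im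

/-- The depth of the bottom vertex. -/
def height (θ : Fin n → ℝ) : ℝ := ∑ i, drop θ i

lemma pathVertex_zero (θ : Fin n → ℝ) (σ : Perm (Fin n)) : pathVertex θ σ 0 = 0 := by
  simp [pathVertex]

lemma pathVertex_succ (θ : Fin n → ℝ) (σ : Perm (Fin n)) (k : Fin n) :
    pathVertex θ σ ((k : ℕ) + 1) = pathVertex θ σ k + sideVec θ (σ k) := by
  have h : Finset.univ.filter (fun i : Fin n => (i : ℕ) < (k : ℕ) + 1) =
      insert k (Finset.univ.filter (fun i : Fin n => (i : ℕ) < k)) := by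
    ext i
    simp only [Finset.mem_filter, Finset.mem_univ, true_and, Finset.mem_insert, Fin.ext_iff]
    omega
  rw [pathVertex, h, Finset.sum_insert (by simp), add_comm, pathVertex]

lemma depth_zero (θ : Fin n → ℝ) (σ : Perm (Fin n)) : depth θ σ 0 = 0 := by
  simp [depth, pathVertex_zero]

lemma depth_last (θ : Fin n → ℝ) (σ : Perm (Fin n)) : depth θ σ n = height θ := by
  simp [depth, pathVertex, height, sideVec_im, Equiv.sum_comp σ (drop θ)]

lemma depth_succ (θ : Fin n → ℝ) (σ : Perm (Fin n)) (k : Fin n) :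
    depth θ σ ((k : ℕ) + 1) = depth θ σ k + drop θ (σ k) := by
  rw [depth, pathVertex_succ, Complex.add_im, sideVec_im, neg_add, neg_neg, depth]

lemma depth_mono (hθ : IsDirections θ) (σ : Perm (Fin n)) : Monotone (depth θ σ) := by
  intro a b hab
  simp only [depth, pathVertex, Complex.im_sum, sideVec_im, Finset.sum_neg_distrib, neg_neg]
  refine Finset.sum_le_sum_of_subset_of_nonneg ?_ fun i _ _ => (drop_pos hθ _).le
  exact Finset.monotone_filter_right _ fun i _ hi => hi.trans_le hab

lemma depth_lt_depth_succ (hθ : IsDirections θ) (σ : Perm (Fin n)) (k : Fin n) :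
    depth θ σ k < depth θ σ ((k : ℕ) + 1) := by
  rw [depth_succ]
  exact lt_add_of_pos_right _ (drop_pos hθ _)

lemma depth_strictMonoOn (hθ : IsDirections θ) (σ : Perm (Fin n)) :
    StrictMonoOn (depth θ σ) (Iic n) := fun a _ _ hb hab =>
  (depth_lt_depth_succ hθ σ ⟨a, hab.trans_le hb⟩).trans_le (depth_mono hθ σ hab)

lemma depth_nonneg (hθ : IsDirections θ) (σ : Perm (Fin n)) (k : ℕ) : 0 ≤ depth θ σ k :=
  (depth_zero θ σ).symm.trans_le (depth_mono hθ σ k.zero_le)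

lemma depth_le_height (hθ : IsDirections θ) (σ : Perm (Fin n)) {k : ℕ} (hk : k ≤ n) :
    depth θ σ k ≤ height θ :=
  (depth_mono hθ σ hk).trans_eq (depth_last θ σ)

lemma exists_depth_lt_le (hθ : IsDirections θ) (σ : Perm (Fin n)) {d : ℝ}
    (h0 : 0 < d) (h1 : d ≤ height θ) :
    ∃ k : Fin n, depth θ σ k < d ∧ d ≤ depth θ σ ((k : ℕ) + 1) := by
  have hd : d ∈ ⋃ k ∈ Ico 0 n, Ioc (depth θ σ k) (depth θ σ (Order.succ k)) := by
    rw [(depth_mono hθ σ).biUnion_Ico_Ioc_map_succ, depth_zero, depth_last]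
    exact ⟨h0, h1⟩
  obtain ⟨k, hk, hkd⟩ := mem_iUnion₂.1 hd
  exact ⟨⟨k, hk.2⟩, hkd⟩

lemma exists_depth_le_le [NeZero n] (hθ : IsDirections θ) (σ : Perm (Fin n)) {d : ℝ}
    (h0 : 0 ≤ d) (h1 : d ≤ height θ) :
    ∃ k : Fin n, depth θ σ k ≤ d ∧ d ≤ depth θ σ ((k : ℕ) + 1) := by
  rcases h0.eq_or_lt with rfl | h0
  · exact ⟨0, (depth_zero θ σ).le, depth_nonneg hθ σ _⟩
  · obtain ⟨k, hk, hk'⟩ := exists_depth_lt_le hθ σ h0 h1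
    exact ⟨k, hk.le, hk'⟩

/-- The part of the drop of the side with label `j` that a path has descended at depth `d`. -/
def dropAbove (θ : Fin n → ℝ) (σ : Perm (Fin n)) (d : ℝ) (j : Fin n) : ℝ :=
  min d (depth θ σ ((σ.symm j : ℕ) + 1)) - min d (depth θ σ (σ.symm j))

lemma dropAbove_of_le (hθ : IsDirections θ) {σ : Perm (Fin n)} {d : ℝ} {j : Fin n}
    (h : d ≤ depth θ σ (σ.symm j)) : dropAbove θ σ d j = 0 := by
  rw [dropAbove, min_eq_left h, min_eq_left (h.trans (depth_lt_depth_succ hθ σ _).le), sub_self]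

lemma dropAbove_of_ge (hθ : IsDirections θ) {σ : Perm (Fin n)} {d : ℝ} {j : Fin n}
    (h : depth θ σ ((σ.symm j : ℕ) + 1) ≤ d) : dropAbove θ σ d j = drop θ j := by
  rw [dropAbove, min_eq_right h, min_eq_right ((depth_lt_depth_succ hθ σ _).le.trans h),
    depth_succ, add_sub_cancel_left, Equiv.apply_symm_apply]

lemma dropAbove_of_mem {σ : Perm (Fin n)} {d : ℝ} {j : Fin n}
    (h : depth θ σ (σ.symm j) ≤ d) (h' : d ≤ depth θ σ ((σ.symm j : ℕ) + 1)) :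
    dropAbove θ σ d j = d - depth θ σ (σ.symm j) := by
  rw [dropAbove, min_eq_left h', min_eq_right h]

lemma dropAbove_pos_iff (hθ : IsDirections θ) {σ : Perm (Fin n)} {d : ℝ} {j : Fin n} :
    0 < dropAbove θ σ d j ↔ depth θ σ (σ.symm j) < d := by
  refine ⟨fun h => not_le.1 fun h' => h.ne' (dropAbove_of_le hθ h'), fun h => ?_⟩
  rw [dropAbove, min_eq_right h.le, sub_pos]
  exact lt_min h (depth_lt_depth_succ hθ σ _)

lemma drop_le_dropAbove_iff (hθ : IsDirections θ) {σ : Perm (Fin n)} {d : ℝ} {j : Fin n} :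
    drop θ j ≤ dropAbove θ σ d j ↔ depth θ σ ((σ.symm j : ℕ) + 1) ≤ d := by
  refine ⟨fun h => ?_, fun h => (dropAbove_of_ge hθ h).ge⟩
  have hpos := (dropAbove_pos_iff hθ).1 ((drop_pos hθ j).trans_le h)
  rw [dropAbove, min_eq_right hpos.le] at h
  rw [depth_succ, Equiv.apply_symm_apply]
  linarith [min_le_left d (depth θ σ ((σ.symm j : ℕ) + 1))]

lemma dropAbove_nonneg (hθ : IsDirections θ) (σ : Perm (Fin n)) (d : ℝ) (j : Fin n) :
    0 ≤ dropAbove θ σ d j :=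
  sub_nonneg.2 (min_le_min_left d (depth_lt_depth_succ hθ σ _).le)

lemma dropAbove_le_drop (hθ : IsDirections θ) (σ : Perm (Fin n)) (d : ℝ) (j : Fin n) :
    dropAbove θ σ d j ≤ drop θ j := by
  by_contra! h
  exact h.ne' (dropAbove_of_ge hθ ((drop_le_dropAbove_iff hθ).1 h.le))

lemma sum_dropAbove (σ : Perm (Fin n)) {d : ℝ} (h0 : 0 ≤ d) (h1 : d ≤ height θ) :
    ∑ j, dropAbove θ σ d j = d := by
  simp only [dropAbove]
  rw [Equiv.sum_comp σ.symm fun i : Fin n =>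
      min d (depth θ σ ((i : ℕ) + 1)) - min d (depth θ σ i),
    Fin.sum_univ_eq_sum_range (fun i => min d (depth θ σ (i + 1)) - min d (depth θ σ i)) n,
    Finset.sum_range_sub (fun i => min d (depth θ σ i)), depth_last, depth_zero,
    min_eq_left h1, min_eq_right h0, sub_zero]

/-- The abscissa of the point of a path at depth `d`. -/
def profile (θ : Fin n → ℝ) (σ : Perm (Fin n)) (d : ℝ) : ℝ :=
  ∑ j, slope θ j * dropAbove θ σ d j

lemma continuous_profile (θ : Fin n → ℝ) (σ : Perm (Fin n)) : Continuous (profile θ σ) := by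
  unfold profile dropAbove
  fun_prop

lemma profile_eq (hθ : IsDirections θ) (σ : Perm (Fin n)) {d : ℝ} {k : Fin n}
    (h1 : depth θ σ k ≤ d) (h2 : d ≤ depth θ σ ((k : ℕ) + 1)) :
    profile θ σ d = (pathVertex θ σ k).re + slope θ (σ k) * (d - depth θ σ k) := by
  have hterm : ∀ i : Fin n, slope θ (σ i) * dropAbove θ σ d (σ i) =
      (if (i : ℕ) < k then (sideVec θ (σ i)).re else 0) +
        (if i = k then slope θ (σ i) * (d - depth θ σ i) else 0) := by
    intro i
    rcases lt_trichotomy i k with h | rfl | h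
    · have hle : depth θ σ ((σ.symm (σ i) : ℕ) + 1) ≤ d := by
        rw [Equiv.symm_apply_apply]
        exact (depth_mono hθ σ (show (i : ℕ) + 1 ≤ k from h)).trans h1
      rw [if_pos (show (i : ℕ) < k from h), if_neg h.ne, dropAbove_of_ge hθ hle, sideVec_re hθ,
        add_zero]
    · rw [if_neg (lt_irrefl _), if_pos rfl, zero_add,
        dropAbove_of_mem (by rwa [Equiv.symm_apply_apply]) (by rwa [Equiv.symm_apply_apply]),
        Equiv.symm_apply_apply]
    · have hle : d ≤ depth θ σ (σ.symm (σ i)) := by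
        rw [Equiv.symm_apply_apply]
        exact h2.trans (depth_mono hθ σ (show (k : ℕ) + 1 ≤ i from h))
      rw [if_neg (show ¬ (i : ℕ) < k from h.not_gt), if_neg h.ne', dropAbove_of_le hθ hle,
        mul_zero, add_zero]
  rw [profile, ← Equiv.sum_comp σ, Finset.sum_congr rfl fun i _ => hterm i,
    Finset.sum_add_distrib, Finset.sum_ite_eq', if_pos (Finset.mem_univ _),
    ← Finset.sum_filter, pathVertex, Complex.re_sum]

lemma mem_pathSide (hθ : IsDirections θ) (σ : Perm (Fin n)) (k : Fin n) (p : ℂ) :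
    p ∈ pathSide θ σ k ↔ depth θ σ k ≤ -p.im ∧ -p.im ≤ depth θ σ ((k : ℕ) + 1) ∧
      p.re = profile θ σ (-p.im) := by
  have hd := drop_pos hθ (σ k)
  rw [pathSide, pathVertex_succ, segment_eq_image', mem_image]
  simp only [add_sub_cancel_left]
  constructor
  · rintro ⟨t, ⟨ht0, ht1⟩, rfl⟩
    have him : -(pathVertex θ σ k + t • sideVec θ (σ k)).im =
        depth θ σ k + t * drop θ (σ k) := by
      simp only [Complex.add_im, Complex.real_smul, Complex.im_ofReal_mul, sideVec_im, depth]
      ring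
    have h1 : depth θ σ k ≤ depth θ σ k + t * drop θ (σ k) := by nlinarith
    have h2 : depth θ σ k + t * drop θ (σ k) ≤ depth θ σ ((k : ℕ) + 1) := by
      rw [depth_succ]
      nlinarith
    refine ⟨him ▸ h1, him ▸ h2, ?_⟩
    rw [him, profile_eq hθ σ h1 h2]
    simp only [Complex.add_re, Complex.real_smul, Complex.re_ofReal_mul, sideVec_re hθ]
    ring
  · rintro ⟨h1, h2, h3⟩
    rw [profile_eq hθ σ h1 h2] at h3
    rw [depth_succ] at h2
    refine ⟨(-p.im - depth θ σ k) / drop θ (σ k), ⟨div_nonneg (by linarith) hd.le, ?_⟩, ?_⟩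
    · rw [div_le_one hd]
      linarith
    · apply Complex.ext
      · simp only [Complex.add_re, Complex.real_smul, Complex.re_ofReal_mul, sideVec_re hθ, h3]
        field_simp
      · simp only [Complex.add_im, Complex.real_smul, Complex.im_ofReal_mul, sideVec_im, depth]
        field_simp
        ring

lemma mem_path [NeZero n] (hθ : IsDirections θ) (σ : Perm (Fin n)) (p : ℂ) :
    p ∈ path θ σ ↔ 0 ≤ -p.im ∧ -p.im ≤ height θ ∧ p.re = profile θ σ (-p.im) := by
  simp only [path, mem_iUnion, mem_pathSide hθ]
  constructor
  · rintro ⟨k, h1, h2, h3⟩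
    exact ⟨(depth_nonneg hθ σ _).trans h1, h2.trans (depth_le_height hθ σ k.2), h3⟩
  · rintro ⟨h1, h2, h3⟩
    obtain ⟨k, hk, hk'⟩ := exists_depth_le_le hθ σ h1 h2
    exact ⟨k, hk, hk', h3⟩

lemma mem_polygon [NeZero n] (hθ : IsDirections θ) (σ : Perm (Fin n)) (p : ℂ) :
    p ∈ polygon θ σ ↔ 0 ≤ -p.im ∧ -p.im ≤ height θ ∧
      profile θ 1 (-p.im) ≤ p.re ∧ p.re ≤ profile θ σ (-p.im) := by
  simp only [polygon, leftBoundary, rightBoundary, mem_path hθ, mem_ofPred_eq]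
  constructor
  · rintro ⟨a, ⟨ha1, ha2, ha3⟩, b, ⟨-, -, hb3⟩, ha, hb, hap, hpb⟩
    rw [ha] at ha1 ha2 ha3
    rw [hb] at hb3
    exact ⟨ha1, ha2, ha3 ▸ hap, hb3 ▸ hpb⟩
  · rintro ⟨h1, h2, h3, h4⟩
    exact ⟨⟨profile θ 1 (-p.im), p.im⟩, ⟨h1, h2, rfl⟩, ⟨profile θ σ (-p.im), p.im⟩,
      ⟨h1, h2, rfl⟩, rfl, rfl, h3, h4⟩

lemma isClosed_polygon [NeZero n] (hθ : IsDirections θ) (σ : Perm (Fin n)) :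
    IsClosed (polygon θ σ) := by
  have h : polygon θ σ = {p | 0 ≤ -p.im ∧ -p.im ≤ height θ ∧
      profile θ 1 (-p.im) ≤ p.re ∧ p.re ≤ profile θ σ (-p.im)} :=
    Set.ext fun p => mem_polygon hθ σ p
  have him : Continuous fun p : ℂ => -p.im := Complex.continuous_im.neg
  rw [h]
  exact (isClosed_le continuous_const him).inter ((isClosed_le him continuous_const).inter
    ((isClosed_le ((continuous_profile θ 1).comp him) Complex.continuous_re).inter
      (isClosed_le Complex.continuous_re ((continuous_profile θ σ).comp him))))

/-! ### Comparison with the leftside boundary -/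

lemma slope_sub_mul_dropAbove_sub_nonneg (hθ : IsDirections θ) (σ : Perm (Fin n)) {d : ℝ}
    {k : Fin n} (hk : depth θ 1 k ≤ d) (hk' : d ≤ depth θ 1 ((k : ℕ) + 1)) (j : Fin n) :
    0 ≤ (slope θ j - slope θ k) * (dropAbove θ σ d j - dropAbove θ 1 d j) := by
  rcases lt_trichotomy j k with h | rfl | h
  · rw [dropAbove_of_ge (σ := 1) hθ ((depth_mono hθ 1 (show (j : ℕ) + 1 ≤ k from h)).trans hk)]
    exact mul_nonneg_of_nonpos_of_nonpos (sub_nonpos.2 (slope_strictMono hθ h).le)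
      (sub_nonpos.2 (dropAbove_le_drop hθ σ d j))
  · rw [sub_self, zero_mul]
  · rw [dropAbove_of_le (σ := 1) hθ (hk'.trans (depth_mono hθ 1 (show (k : ℕ) + 1 ≤ j from h))),
      sub_zero]
    exact mul_nonneg (sub_nonneg.2 (slope_strictMono hθ h).le) (dropAbove_nonneg hθ σ d j)

lemma profile_sub_profile_one (σ : Perm (Fin n)) {d : ℝ} (h0 : 0 ≤ d) (h1 : d ≤ height θ)
    (k : Fin n) :
    profile θ σ d - profile θ 1 d =
      ∑ j, (slope θ j - slope θ k) * (dropAbove θ σ d j - dropAbove θ 1 d j) := by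
  have h := (sum_dropAbove σ h0 h1).trans (sum_dropAbove 1 h0 h1).symm
  simp only [sub_mul, mul_sub, Finset.sum_sub_distrib, ← Finset.mul_sum, h, profile]
  ring

lemma profile_one_le [NeZero n] (hθ : IsDirections θ) (σ : Perm (Fin n)) {d : ℝ}
    (h0 : 0 ≤ d) (h1 : d ≤ height θ) : profile θ 1 d ≤ profile θ σ d := by
  obtain ⟨k, hk, hk'⟩ := exists_depth_le_le hθ 1 h0 h1
  rw [← sub_nonneg, profile_sub_profile_one σ h0 h1 k]
  exact Finset.sum_nonneg fun j _ => slope_sub_mul_dropAbove_sub_nonneg hθ σ hk hk' j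

lemma dropAbove_eq_of_profile_eq (hθ : IsDirections θ) {σ : Perm (Fin n)} {d : ℝ}
    (h0 : 0 ≤ d) (h1 : d ≤ height θ) (h : profile θ σ d = profile θ 1 d) {k : Fin n}
    (hk : depth θ 1 k ≤ d) (hk' : d ≤ depth θ 1 ((k : ℕ) + 1)) :
    dropAbove θ σ d = dropAbove θ 1 d := by
  have hsum := profile_sub_profile_one σ h0 h1 k
  rw [h, sub_self, eq_comm, Finset.sum_eq_zero_iff_of_nonneg
    fun j _ => slope_sub_mul_dropAbove_sub_nonneg hθ σ hk hk' j] at hsum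
  have hne : ∀ j ≠ k, dropAbove θ σ d j = dropAbove θ 1 d j := fun j hj =>
    sub_eq_zero.1 ((mul_eq_zero.1 (hsum j (Finset.mem_univ j))).resolve_left
      (sub_ne_zero.2 ((slope_strictMono hθ).injective.ne hj)))
  have hsum_eq := (sum_dropAbove σ h0 h1).trans (sum_dropAbove 1 h0 h1).symm
  rw [← Finset.add_sum_erase _ _ (Finset.mem_univ k),
    ← Finset.add_sum_erase _ (dropAbove θ 1 d) (Finset.mem_univ k),
    Finset.sum_congr rfl fun j hj => hne j (Finset.ne_of_mem_erase hj)] at hsum_eq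
  funext j
  rcases eq_or_ne j k with rfl | hj
  · exact add_right_cancel hsum_eq
  · exact hne j hj

lemma image_eq_of_isLowerSet_preimage {α : Type*} [LinearOrder α] [Finite α] (σ : Perm α)
    {A : Set α} (hA : IsLowerSet A) (hσA : IsLowerSet (σ ⁻¹' A)) : σ '' A = A := by
  have hcard : (σ '' A).ncard = A.ncard := ncard_image_of_injective A σ.injective
  rcases hA.total hσA with h | h
  · exact eq_of_subset_of_ncard_le (image_subset_iff.2 h) hcard.ge
  · have h' : A ⊆ σ '' A := by rwa [Equiv.image_eq_preimage_symm, ← Equiv.preimage_subset,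
      ← preimage_comp, Equiv.symm_comp_self, preimage_id]
    exact (eq_of_subset_of_ncard_le h' hcard.le).symm

lemma FullySupported.not_isLowerSet_preimage {w : Perm (Fin n)} (hw : FullySupported w) {r : ℕ}
    (hr : 1 ≤ r) (hrn : r < n) : ¬ IsLowerSet (w ⁻¹' {i | (i : ℕ) < r}) := fun h =>
  hw r hr hrn (image_eq_of_isLowerSet_preimage w
    (fun a b hba (ha : (a : ℕ) < r) => show (b : ℕ) < r from lt_of_le_of_lt hba ha) h)

lemma profile_one_lt (hθ : IsDirections θ) (hn : 2 ≤ n) {w : Perm (Fin n)}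
    (hw : FullySupported w) {d : ℝ} {k : Fin n}
    (hk : depth θ 1 k < d) (hk' : d < depth θ 1 ((k : ℕ) + 1)) :
    profile θ 1 d < profile θ w d := by
  have : NeZero n := ⟨by omega⟩
  have h0 : 0 ≤ d := (depth_nonneg hθ 1 k).trans hk.le
  have h1 : d ≤ height θ := hk'.le.trans (depth_le_height hθ 1 k.2)
  refine (profile_one_le hθ w h0 h1).lt_of_ne fun heq => ?_
  have hdrop := dropAbove_eq_of_profile_eq hθ h0 h1 heq.symm hk.le hk'.le
  have hlt : ∀ i, (w i : ℕ) < k ↔ depth θ w ((i : ℕ) + 1) ≤ d := fun i => by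
    have h := drop_le_dropAbove_iff (σ := w) (d := d) (j := w i) hθ
    rw [hdrop, drop_le_dropAbove_iff hθ, Equiv.symm_apply_apply] at h
    rw [← h]
    exact ⟨fun h => (depth_mono hθ 1 h).trans hk.le, fun h => not_le.1 fun h' =>
      (h.trans_lt hk').not_ge (depth_mono hθ 1 (Nat.add_le_add_right h' 1))⟩
  have hle : ∀ i, (w i : ℕ) < k + 1 ↔ depth θ w i < d := fun i => by
    have h := dropAbove_pos_iff (σ := w) (d := d) (j := w i) hθ
    rw [hdrop, dropAbove_pos_iff hθ, Equiv.symm_apply_apply] at h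
    rw [← h, Nat.lt_succ_iff]
    exact ⟨fun h => (depth_mono hθ 1 h).trans_lt hk, fun h => not_lt.1 fun h' =>
      (hk'.trans_le (depth_mono hθ 1 h')).not_gt h⟩
  rcases Nat.eq_zero_or_pos k with hk0 | hk0
  · refine hw.not_isLowerSet_preimage (Nat.le_add_left 1 k) (by omega) fun i j hji hi => ?_
    exact (hle j).2 ((depth_mono hθ w hji).trans_lt ((hle i).1 hi))
  · refine hw.not_isLowerSet_preimage hk0 k.2 fun i j hji hi => ?_
    exact (hlt j).2 ((depth_mono hθ w (Nat.add_le_add_right hji 1)).trans ((hlt i).1 hi))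

/-! ### Swapping two adjacent sides -/

lemma symm_mul_swap_apply (σ : Perm (Fin n)) (k l i : Fin n) :
    (σ * swap k l).symm (σ i) = swap k l i := by
  rw [Equiv.symm_apply_eq, Perm.mul_apply, swap_apply_self]

lemma pathVertex_mul_swap (σ : Perm (Fin n)) {k l : Fin n} (hkl : (l : ℕ) = k + 1)
    {m : ℕ} (hm : m ≠ l) : pathVertex θ (σ * swap k l) m = pathVertex θ σ m := by
  have hlt : ∀ i : Fin n, (swap k l i : ℕ) < m ↔ (i : ℕ) < m := fun i => by
    rw [swap_apply_def]
    split_ifs with h h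
    · rw [h]; omega
    · rw [h]; omega
    · rfl
  rw [pathVertex, pathVertex, Finset.sum_filter, Finset.sum_filter, ← Equiv.sum_comp (swap k l)]
  simp only [hlt, Perm.mul_apply, swap_apply_self]

lemma depth_mul_swap (σ : Perm (Fin n)) {k l : Fin n} (hkl : (l : ℕ) = k + 1)
    {m : ℕ} (hm : m ≠ l) : depth θ (σ * swap k l) m = depth θ σ m := by
  rw [depth, depth, pathVertex_mul_swap σ hkl hm]

lemma dropAbove_of_notMem_Ioo (hθ : IsDirections θ) {σ : Perm (Fin n)} {k l : Fin n}
    (hkl : (l : ℕ) = k + 1) {d : ℝ} (hd : d ∉ Ioo (depth θ σ k) (depth θ σ ((l : ℕ) + 1)))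
    {j : Fin n} (hj : σ.symm j = k ∨ σ.symm j = l) :
    dropAbove θ σ d j = if d ≤ depth θ σ k then 0 else drop θ j := by
  have hkj : (k : ℕ) ≤ σ.symm j ∧ (σ.symm j : ℕ) ≤ l := by rcases hj with h | h <;> omega
  split_ifs with h
  · exact dropAbove_of_le hθ (h.trans (depth_mono hθ σ hkj.1))
  · exact dropAbove_of_ge hθ ((depth_mono hθ σ (Nat.add_le_add_right hkj.2 1)).trans
      (not_lt.1 fun h' => hd ⟨not_le.1 h, h'⟩))

lemma profile_mul_swap_of_notMem_Ioo (hθ : IsDirections θ) (σ : Perm (Fin n)) {k l : Fin n}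
    (hkl : (l : ℕ) = k + 1) {d : ℝ} (hd : d ∉ Ioo (depth θ σ k) (depth θ σ ((l : ℕ) + 1))) :
    profile θ (σ * swap k l) d = profile θ σ d := by
  have hk := depth_mul_swap (θ := θ) σ hkl (m := k) (by omega)
  have hl := depth_mul_swap (θ := θ) σ hkl (m := l + 1) (by omega)
  refine Finset.sum_congr rfl fun j _ => congrArg _ ?_
  obtain ⟨i, rfl⟩ := σ.surjective j
  have hsymm := symm_mul_swap_apply σ k l i
  by_cases hi : i = k ∨ i = l
  · have hi' : swap k l i = k ∨ swap k l i = l := by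
      rcases hi with rfl | rfl
      · exact Or.inr (swap_apply_left _ _)
      · exact Or.inl (swap_apply_right _ _)
    rw [dropAbove_of_notMem_Ioo hθ hkl (by rwa [hk, hl]) (hsymm ▸ hi'),
      dropAbove_of_notMem_Ioo hθ hkl hd ((σ.symm_apply_apply i).symm ▸ hi), hk]
  · obtain ⟨hik, hil⟩ := not_or.1 hi
    rw [dropAbove, dropAbove, hsymm, swap_apply_of_ne_of_ne hik hil, Equiv.symm_apply_apply,
      depth_mul_swap σ hkl (Fin.val_ne_of_ne hil),
      depth_mul_swap σ hkl fun h => hik (Fin.ext (by omega))]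

lemma profile_depth_add (hθ : IsDirections θ) (σ : Perm (Fin n)) {k l : Fin n}
    (hkl : (l : ℕ) = k + 1) {u : ℝ} (h0 : 0 ≤ u) (h1 : u ≤ drop θ (σ k) + drop θ (σ l)) :
    profile θ σ (depth θ σ k + u) = (pathVertex θ σ k).re + slope θ (σ l) * u +
      (slope θ (σ k) - slope θ (σ l)) * min u (drop θ (σ k)) := by
  have hk := depth_succ θ σ k
  have hl := depth_succ θ σ l
  rcases le_total u (drop θ (σ k)) with h | h
  · rw [profile_eq hθ σ (k := k) (by linarith) (by linarith), min_eq_left h]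
    ring
  · rw [← hkl] at hk
    rw [profile_eq hθ σ (k := l) (by linarith) (by linarith), min_eq_right h, hk, hkl,
      pathVertex_succ, Complex.add_re, sideVec_re hθ]
    ring

/-- The positions `k` and `l` are adjacent, in this order, and form a descent of `σ`. -/
structure IsDescent (σ : Perm (Fin n)) (k l : Fin n) : Prop where
  val_eq : (l : ℕ) = k + 1
  lt : σ l < σ k

lemma IsDescent.pos_lt {σ : Perm (Fin n)} {k l : Fin n} (h : IsDescent σ k l) : k < l :=
  Fin.lt_def.2 (h.val_eq ▸ Nat.lt_succ_self k)

lemma IsDescent.induction {P : Perm (Fin n) → Prop}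
    (step : ∀ σ, (∀ k l, IsDescent σ k l → P (σ * swap k l)) → P σ) (σ : Perm (Fin n)) : P σ := by
  have hwf : WellFounded fun σ τ : Perm (Fin n) => toLex ⇑σ < toLex ⇑τ :=
    InvImage.wf (fun σ : Perm (Fin n) => toLex ⇑σ) wellFounded_lt
  refine hwf.induction σ fun σ ih => step σ fun k l h => ih _ ⟨k, fun i (hi : i < k) => ?_, ?_⟩
  · simp [swap_apply_of_ne_of_ne hi.ne (hi.trans h.pos_lt).ne]
  · simpa using h.lt

lemma exists_isDescent {σ : Perm (Fin n)} {i j : Fin n} (hij : i < j) (hσ : σ j < σ i) :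
    ∃ k l, IsDescent σ k l ∧ σ i ≤ σ k := by
  obtain ⟨k, ⟨hkj, hk⟩, hmax⟩ :=
    exists_maximal_of_wellFoundedGT (fun k => k < j ∧ σ i ≤ σ k) ⟨i, hij, le_rfl⟩
  let l : Fin n := ⟨k + 1, by omega⟩
  have hkl : k < l := Fin.lt_def.2 (Nat.lt_succ_self k)
  refine ⟨k, l, ⟨rfl, ?_⟩, hk⟩
  rcases (show l ≤ j from hkj).eq_or_lt with hlj | hlj
  · exact hlj ▸ hσ.trans_le hk
  · exact lt_of_not_ge fun h => hkl.not_ge (hmax ⟨hlj, hk.trans h⟩ hkl.le)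

lemma IsDescent.symm_lt_symm {σ : Perm (Fin n)} {k l : Fin n} (h : IsDescent σ k l) {x y : Fin n}
    (hxy : x < y) (hlt : (σ * swap k l).symm y < (σ * swap k l).symm x) :
    σ.symm y < σ.symm x := by
  obtain ⟨a, rfl⟩ := σ.surjective x
  obtain ⟨b, rfl⟩ := σ.surjective y
  have hkl : (l : ℕ) = k + 1 := h.val_eq
  have hne : ¬ (a = k ∧ b = l) := by
    rintro ⟨rfl, rfl⟩
    exact hxy.not_gt h.lt
  rw [symm_mul_swap_apply, symm_mul_swap_apply, swap_apply_def, swap_apply_def] at hlt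
  rw [Equiv.symm_apply_apply, Equiv.symm_apply_apply]
  split_ifs at hlt <;> omega

lemma profile_mul_swap_depth_add (hθ : IsDirections θ) (σ : Perm (Fin n)) {k l : Fin n}
    (hkl : (l : ℕ) = k + 1) {u : ℝ} (h0 : 0 ≤ u) (h1 : u ≤ drop θ (σ k) + drop θ (σ l)) :
    profile θ (σ * swap k l) (depth θ σ k + u) = (pathVertex θ σ k).re + slope θ (σ k) * u -
      (slope θ (σ k) - slope θ (σ l)) * min u (drop θ (σ l)) := by
  have hk : (k : ℕ) ≠ l := by omega
  have h := profile_depth_add hθ (σ * swap k l) hkl h0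
  simp only [Perm.mul_apply, swap_apply_left, swap_apply_right, depth_mul_swap σ hkl hk,
    pathVertex_mul_swap σ hkl hk] at h
  rw [h (by linarith)]
  ring

lemma IsDescent.profile_le (hθ : IsDirections θ) {σ : Perm (Fin n)} {k l : Fin n}
    (h : IsDescent σ k l) (d : ℝ) : profile θ (σ * swap k l) d ≤ profile θ σ d := by
  by_cases hd : d ∈ Ioo (depth θ σ k) (depth θ σ ((l : ℕ) + 1))
  · obtain ⟨u, rfl⟩ : ∃ u, d = depth θ σ k + u := ⟨d - depth θ σ k, by ring⟩
    rw [mem_Ioo, depth_succ, h.val_eq, depth_succ] at hd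
    rw [profile_mul_swap_depth_add hθ σ h.val_eq (by linarith) (by linarith),
      profile_depth_add hθ σ h.val_eq (by linarith) (by linarith)]
    have hmin : u ≤ min u (drop θ (σ k)) + min u (drop θ (σ l)) := by
      rcases min_choice u (drop θ (σ k)) with e | e <;>
      rcases min_choice u (drop θ (σ l)) with e' | e' <;> rw [e, e'] <;>
      linarith [drop_pos hθ (σ k), drop_pos hθ (σ l)]
    nlinarith [slope_strictMono hθ h.lt]
  · exact (profile_mul_swap_of_notMem_Ioo hθ σ h.val_eq hd).le

/-! ### Tiles -/

namespace Tile

lemma slope_sub_pos (hθ : IsDirections θ) (t : Tile n) : 0 < slope θ t.hi - slope θ t.lo :=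
  sub_pos.2 (slope_strictMono hθ t.lo_lt_hi)

/-- Affine coordinates adapted to a tile: the displacement from its top vertex is decomposed along
the directions `t.lo` and `t.hi`, and each of the two components is measured by its descent. -/
def coords (hθ : IsDirections θ) (t : Tile n) : ℂ ≃ₜ ℝ × ℝ where
  toFun p := ((slope θ t.hi * (t.top.im - p.im) - (p.re - t.top.re)) /
      (slope θ t.hi - slope θ t.lo),
    ((p.re - t.top.re) - slope θ t.lo * (t.top.im - p.im)) / (slope θ t.hi - slope θ t.lo))
  invFun x := ⟨t.top.re + slope θ t.lo * x.1 + slope θ t.hi * x.2, t.top.im - (x.1 + x.2)⟩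
  left_inv p := by
    have h := (t.slope_sub_pos hθ).ne'
    apply Complex.ext
    · simp only
      field_simp
      ring
    · simp only
      field_simp
      ring
  right_inv x := by
    have h := (t.slope_sub_pos hθ).ne'
    apply Prod.ext
    · simp only
      field_simp
      ring
    · simp only
      field_simp
      ring
  continuous_toFun := by fun_prop
  continuous_invFun := by
    have h : Continuous fun x : ℝ × ℝ =>
        (t.top.re + slope θ t.lo * x.1 + slope θ t.hi * x.2, t.top.im - (x.1 + x.2)) := by fun_prop
    exact Complex.equivRealProdCLM.symm.continuous.comp h

lemma coords_symm_re (hθ : IsDirections θ) (t : Tile n) (x : ℝ × ℝ) :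
    ((t.coords hθ).symm x).re = t.top.re + slope θ t.lo * x.1 + slope θ t.hi * x.2 := rfl

lemma coords_symm_im (hθ : IsDirections θ) (t : Tile n) (x : ℝ × ℝ) :
    ((t.coords hθ).symm x).im = t.top.im - (x.1 + x.2) := rfl

lemma re_eq_coords (hθ : IsDirections θ) (t : Tile n) (p : ℂ) :
    p.re = t.top.re + slope θ t.lo * (t.coords hθ p).1 + slope θ t.hi * (t.coords hθ p).2 :=
  congrArg Complex.re ((t.coords hθ).symm_apply_apply p).symm

lemma im_eq_coords (hθ : IsDirections θ) (t : Tile n) (p : ℂ) :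
    p.im = t.top.im - ((t.coords hθ p).1 + (t.coords hθ p).2) :=
  congrArg Complex.im ((t.coords hθ).symm_apply_apply p).symm

lemma coords_add_ofReal (hθ : IsDirections θ) (t : Tile n) (p : ℂ) (δ : ℝ) :
    t.coords hθ (p + δ) = ((t.coords hθ p).1 - δ / (slope θ t.hi - slope θ t.lo),
      (t.coords hθ p).2 + δ / (slope θ t.hi - slope θ t.lo)) := by
  have h := (t.slope_sub_pos hθ).ne'
  rw [← Homeomorph.eq_symm_apply]
  apply Complex.ext
  · rw [Complex.add_re, Complex.ofReal_re, coords_symm_re, t.re_eq_coords hθ p]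
    field_simp
    ring
  · rw [Complex.add_im, Complex.ofReal_im, coords_symm_im, t.im_eq_coords hθ p]
    ring

lemma coords_symm_mul_drop (hθ : IsDirections θ) (t : Tile n) (a b : ℝ) :
    (t.coords hθ).symm (a * drop θ t.lo, b * drop θ t.hi) =
      t.top + a • sideVec θ t.lo + b • sideVec θ t.hi := by
  apply Complex.ext
  · simp only [coords_symm_re, Complex.add_re, Complex.real_smul, Complex.re_ofReal_mul,
      sideVec_re hθ]
    ring
  · simp only [coords_symm_im, Complex.add_im, Complex.real_smul, Complex.im_ofReal_mul,
      sideVec_im]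
    ring

lemma region_eq_preimage_coords (hθ : IsDirections θ) (t : Tile n) :
    t.region θ = t.coords hθ ⁻¹' (Icc 0 (drop θ t.lo) ×ˢ Icc 0 (drop θ t.hi)) := by
  have hlo := drop_pos hθ t.lo
  have hhi := drop_pos hθ t.hi
  ext p
  constructor
  · rintro ⟨a, ⟨ha0, ha1⟩, b, ⟨hb0, hb1⟩, rfl⟩
    rw [← t.coords_symm_mul_drop hθ, mem_preimage, Homeomorph.apply_symm_apply]
    exact ⟨⟨by positivity, mul_le_of_le_one_left hlo.le ha1⟩,
      by positivity, mul_le_of_le_one_left hhi.le hb1⟩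
  · rintro ⟨⟨ha0, ha1⟩, hb0, hb1⟩
    refine ⟨_, ⟨div_nonneg ha0 hlo.le, (div_le_one hlo).2 ha1⟩,
      _, ⟨div_nonneg hb0 hhi.le, (div_le_one hhi).2 hb1⟩, ?_⟩
    rw [← t.coords_symm_mul_drop hθ, div_mul_cancel₀ _ hlo.ne', div_mul_cancel₀ _ hhi.ne',
      Homeomorph.symm_apply_apply]

lemma interior_region (hθ : IsDirections θ) (t : Tile n) :
    interior (t.region θ) = t.coords hθ ⁻¹' (Ioo 0 (drop θ t.lo) ×ˢ Ioo 0 (drop θ t.hi)) := by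
  rw [t.region_eq_preimage_coords hθ, ← Homeomorph.preimage_interior, interior_prod_eq,
    interior_Icc, interior_Icc]

lemma isClosed_region (hθ : IsDirections θ) (t : Tile n) : IsClosed (t.region θ) := by
  rw [t.region_eq_preimage_coords hθ]
  exact (isClosed_Icc.prod isClosed_Icc).preimage (t.coords hθ).continuous

lemma closure_interior_region (hθ : IsDirections θ) (t : Tile n) :
    closure (interior (t.region θ)) = t.region θ := by
  rw [t.interior_region hθ, t.region_eq_preimage_coords hθ, ← Homeomorph.preimage_closure,
    closure_prod_eq, closure_Ioo (drop_pos hθ _).ne, closure_Ioo (drop_pos hθ _).ne]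

lemma convex_region (θ : Fin n → ℝ) (t : Tile n) : Convex ℝ (t.region θ) := by
  rintro _ ⟨a, ha, b, hb, rfl⟩ _ ⟨a', ha', b', hb', rfl⟩ μ ν hμ hν hμν
  refine ⟨_, convex_Icc 0 1 ha ha' hμ hν hμν, _, convex_Icc 0 1 hb hb' hμ hν hμν, ?_⟩
  obtain rfl : ν = 1 - μ := by linarith
  module

lemma top_mem_region (θ : Fin n → ℝ) (t : Tile n) : t.top ∈ t.region θ :=
  ⟨0, by simp, 0, by simp, by simp⟩

lemma bot_mem_region (θ : Fin n → ℝ) (t : Tile n) :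
    t.top + sideVec θ t.lo + sideVec θ t.hi ∈ t.region θ :=
  ⟨1, by simp, 1, by simp, by simp⟩

lemma add_ofReal_mem_interior (hθ : IsDirections θ) (t : Tile n) {p : ℂ} {δ ε : ℝ}
    (hp : p ∈ t.region θ) (hq : p + (ε : ℂ) ∈ t.region θ) (hδ : 0 < δ) (hδε : δ < ε) :
    p + (δ : ℂ) ∈ interior (t.region θ) := by
  rw [t.region_eq_preimage_coords hθ, mem_preimage] at hp hq
  rw [t.interior_region hθ, mem_preimage, coords_add_ofReal]
  rw [coords_add_ofReal] at hq
  have h1 := div_pos hδ (t.slope_sub_pos hθ)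
  have h2 := div_lt_div_of_pos_right hδε (t.slope_sub_pos hθ)
  exact ⟨⟨by linarith [hq.1.1], by linarith [hp.1.2]⟩,
    by linarith [hp.2.1], by linarith [hq.2.2]⟩

lemma exists_sub_ofReal_mem_interior (hθ : IsDirections θ) (t : Tile n) {p : ℂ}
    (hp : p ∈ t.region θ) (hlo : (t.coords hθ p).1 < drop θ t.lo)
    (hhi : 0 < (t.coords hθ p).2) : ∃ δ : ℝ, δ < 0 ∧ p + (δ : ℂ) ∈ interior (t.region θ) := by
  rw [t.region_eq_preimage_coords hθ, mem_preimage] at hp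
  have hpos := t.slope_sub_pos hθ
  obtain ⟨η, hη, hη'⟩ := exists_between (lt_min (sub_pos.2 hlo) hhi)
  obtain ⟨hη1, hη2⟩ := lt_min_iff.1 hη'
  refine ⟨-(η * (slope θ t.hi - slope θ t.lo)), neg_lt_zero.2 (mul_pos hη hpos), ?_⟩
  rw [t.interior_region hθ, mem_preimage, coords_add_ofReal, neg_div,
    mul_div_cancel_right₀ _ hpos.ne']
  exact ⟨⟨by linarith [hp.1.1], by linarith⟩, by linarith, by linarith [hp.2.2]⟩

lemma add_ofReal_notMem_region (hθ : IsDirections θ) (t : Tile n) {p : ℂ} {δ : ℝ}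
    (h : (t.coords hθ p).1 = 0 ∨ (t.coords hθ p).2 = drop θ t.hi) (hδ : 0 < δ) :
    p + (δ : ℂ) ∉ t.region θ := by
  rw [t.region_eq_preimage_coords hθ, mem_preimage, coords_add_ofReal]
  rintro ⟨⟨hlo, -⟩, -, hhi⟩
  have hdiv := div_pos hδ (t.slope_sub_pos hθ)
  rcases h with h | h <;> linarith

end Tile

/-- The tile spanned by the two sides of a path at a descent. -/
def IsDescent.tile {σ : Perm (Fin n)} {k l : Fin n} (θ : Fin n → ℝ) (h : IsDescent σ k l) :
    Tile n :=
  ⟨pathVertex θ σ k, σ l, σ k, h.lt⟩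

namespace IsDescent

variable {σ : Perm (Fin n)} {k l : Fin n}

lemma mem_region_tile (hθ : IsDirections θ) (h : IsDescent σ k l) (p : ℂ) :
    p ∈ (h.tile θ).region θ ↔ -p.im ∈ Icc (depth θ σ k) (depth θ σ ((l : ℕ) + 1)) ∧
      profile θ (σ * swap k l) (-p.im) ≤ p.re ∧ p.re ≤ profile θ σ (-p.im) := by
  obtain ⟨⟨α, β⟩, rfl⟩ := ((h.tile θ).coords hθ).symm.surjective p
  have hpos := (h.tile θ).slope_sub_pos hθ
  have hdepth : -(((h.tile θ).coords hθ).symm (α, β)).im = depth θ σ k + (α + β) := by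
    simp only [Tile.coords_symm_im, IsDescent.tile, depth]
    ring
  have hbot : depth θ σ ((l : ℕ) + 1) = depth θ σ k + (drop θ (σ k) + drop θ (σ l)) := by
    rw [depth_succ, h.val_eq, depth_succ, add_assoc]
  rw [Tile.region_eq_preimage_coords hθ, mem_preimage, Homeomorph.apply_symm_apply, hdepth, hbot,
    Tile.coords_symm_re]
  simp only [mem_prod, mem_Icc, IsDescent.tile, add_le_add_iff_left,
    le_add_iff_nonneg_right] at hpos ⊢
  constructor
  · rintro ⟨⟨hα, hα'⟩, hβ, hβ'⟩
    have hle : α + β ≤ drop θ (σ k) + drop θ (σ l) := by linarith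
    rw [profile_mul_swap_depth_add hθ σ h.val_eq (add_nonneg hα hβ) hle,
      profile_depth_add hθ σ h.val_eq (add_nonneg hα hβ) hle]
    have h1 : α ≤ min (α + β) (drop θ (σ l)) := le_min (by linarith) hα'
    have h2 : β ≤ min (α + β) (drop θ (σ k)) := le_min (by linarith) hβ'
    exact ⟨⟨add_nonneg hα hβ, hle⟩, by nlinarith, by nlinarith⟩
  · rintro ⟨⟨h0, hle⟩, hre, hre'⟩
    rw [profile_mul_swap_depth_add hθ σ h.val_eq h0 hle] at hre
    rw [profile_depth_add hθ σ h.val_eq h0 hle] at hre'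
    have h1 : α ≤ min (α + β) (drop θ (σ l)) := le_of_mul_le_mul_left (by linarith) hpos
    have h2 : β ≤ min (α + β) (drop θ (σ k)) := le_of_mul_le_mul_left (by linarith) hpos
    rw [le_min_iff] at h1 h2
    exact ⟨⟨by linarith, h1.2⟩, by linarith, h2.2⟩

lemma polygon_eq [NeZero n] (hθ : IsDirections θ) (h : IsDescent σ k l) :
    polygon θ σ = polygon θ (σ * swap k l) ∪ (h.tile θ).region θ := by
  ext p
  rw [mem_union, mem_polygon hθ, mem_polygon hθ, h.mem_region_tile hθ]
  constructor
  · rintro ⟨h0, h1, hl, hr⟩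
    by_cases hd : -p.im ∈ Icc (depth θ σ k) (depth θ σ ((l : ℕ) + 1))
    · rcases le_total p.re (profile θ (σ * swap k l) (-p.im)) with h' | h'
      · exact Or.inl ⟨h0, h1, hl, h'⟩
      · exact Or.inr ⟨hd, h', hr⟩
    · rw [profile_mul_swap_of_notMem_Ioo hθ σ h.val_eq fun h' => hd (Ioo_subset_Icc_self h')]
      exact Or.inl ⟨h0, h1, hl, hr⟩
  · rintro (⟨h0, h1, hl, hr⟩ | ⟨⟨hk, hl⟩, hre, hre'⟩)
    · exact ⟨h0, h1, hl, hr.trans (h.profile_le hθ _)⟩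
    · have h0 : 0 ≤ -p.im := (depth_nonneg hθ σ k).trans hk
      have h1 : -p.im ≤ height θ := hl.trans (depth_le_height hθ σ l.2)
      exact ⟨h0, h1, (profile_one_le hθ _ h0 h1).trans hre, hre'⟩

end IsDescent

/-! ### Horizontal rays -/

lemma tendsto_add_ofReal (p : ℂ) (s : Set ℝ) :
    Tendsto (fun δ : ℝ => p + (δ : ℂ)) (𝓝[s] 0) (𝓝 p) := by
  have h : Continuous fun δ : ℝ => p + (δ : ℂ) := by fun_prop
  simpa using (h.tendsto 0).mono_left nhdsWithin_le_nhds

lemma exists_mem_of_eventually_mem_biUnion {ι α X : Type*} [TopologicalSpace X] {T : Finset ι}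
    {C : ι → Set X} (hC : ∀ i ∈ T, IsClosed (C i)) {l : Filter α} [l.NeBot] {f : α → X} {x : X}
    (hf : Tendsto f l (𝓝 x)) (h : ∀ᶠ a in l, f a ∈ ⋃ i ∈ T, C i) :
    ∃ i ∈ T, x ∈ C i ∧ ∃ᶠ a in l, f a ∈ C i := by
  obtain ⟨i, hi, hfreq⟩ : ∃ i ∈ T, ∃ᶠ a in l, f a ∈ C i := by
    by_contra! hno
    have hall : ∀ᶠ a in l, ∀ i ∈ T, f a ∉ C i :=
      (eventually_all_finset T).2 hno
    obtain ⟨a, ha, ha'⟩ := (h.and hall).exists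
    obtain ⟨i, hi, hai⟩ := mem_iUnion₂.1 ha
    exact ha' i hi hai
  exact ⟨i, hi, (hC i hi).mem_of_frequently_of_tendsto hfreq hf, hfreq⟩

lemma IsDescent.disjoint_interior_region_tile [NeZero n] (hθ : IsDirections θ)
    {σ : Perm (Fin n)} {k l : Fin n} (h : IsDescent σ k l) :
    Disjoint (interior ((h.tile θ).region θ)) (polygon θ (σ * swap k l)) := by
  rw [disjoint_left]
  intro p hp hpoly
  have hmem : ∀ᶠ δ : ℝ in 𝓝[<] 0, p + (δ : ℂ) ∈ (h.tile θ).region θ :=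
    (tendsto_add_ofReal p _).eventually (mem_interior_iff_mem_nhds.1 hp)
  obtain ⟨δ, hδ, hδ0⟩ := (hmem.and self_mem_nhdsWithin).exists
  have hle := ((h.mem_region_tile hθ _).1 hδ).2.1
  have hpre := ((mem_polygon hθ _ p).1 hpoly).2.2.2
  rw [Complex.add_im, Complex.ofReal_im, add_zero, Complex.add_re, Complex.ofReal_re] at hle
  linarith [show δ < 0 from hδ0]

/-! ### The rightmost member of a family of convex sets -/

lemma exists_mem_im_eq {C : Set ℂ} (hC : Convex ℝ C) {p q : ℂ} (hp : p ∈ C) (hq : q ∈ C) {y : ℝ}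
    (hpy : p.im ≤ y) (hyq : y ≤ q.im) : ∃ r ∈ C, r.im = y :=
  (hC.linear_image Complex.imLm).ordConnected.out ⟨p, hp, rfl⟩ ⟨q, hq, rfl⟩ ⟨hpy, hyq⟩

lemma re_lt_re_of_disjoint {C D : Set ℂ} (hC : Convex ℝ C) (hD : Convex ℝ D) (hCD : Disjoint C D)
    {p₁ p₂ q₁ q₂ : ℂ} (hp₁ : p₁ ∈ C) (hp₂ : p₂ ∈ C) (hq₁ : q₁ ∈ D) (hq₂ : q₂ ∈ D)
    (h₁ : p₁.im = q₁.im) (h₂ : p₂.im = q₂.im) (hlt : p₁.re < q₁.re) : p₂.re < q₂.re := by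
  by_contra! hle
  have hx : 0 < q₁.re - p₁.re := sub_pos.2 hlt
  have hy : 0 ≤ p₂.re - q₂.re := sub_nonneg.2 hle
  set x := q₁.re - p₁.re with hx_def
  set y := p₂.re - q₂.re with hy_def
  have hxy : x + y ≠ 0 := (add_pos_of_pos_of_nonneg hx hy).ne'
  have ha : 0 ≤ y / (x + y) := by positivity
  have hb : 0 ≤ x / (x + y) := by positivity
  have hab : y / (x + y) + x / (x + y) = 1 := by field_simp; ring
  have heq : (y / (x + y)) • p₁ + (x / (x + y)) • p₂ =
      (y / (x + y)) • q₁ + (x / (x + y)) • q₂ := by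
    apply Complex.ext
    · simp only [Complex.add_re, Complex.real_smul, Complex.re_ofReal_mul]
      field_simp
      linear_combination y * hx_def - x * hy_def
    · simp only [Complex.add_im, Complex.real_smul, Complex.im_ofReal_mul, h₁, h₂]
  exact disjoint_left.1 hCD (hC hp₁ hp₂ ha hb hab) (heq ▸ hD hq₁ hq₂ ha hb hab)

/-- Some point of `C` lies to the left of a point of `D` at the same height. -/
def LeftOf (C D : Set ℂ) : Prop := ∃ p ∈ C, ∃ q ∈ D, p.im = q.im ∧ p.re < q.re

lemma LeftOf.asymm {C D : Set ℂ} (hC : Convex ℝ C) (hD : Convex ℝ D) (hCD : Disjoint C D)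
    (h : LeftOf C D) : ¬ LeftOf D C := by
  rintro ⟨q', hq', p', hp', him', hlt'⟩
  obtain ⟨p, hp, q, hq, him, hlt⟩ := h
  exact (re_lt_re_of_disjoint hC hD hCD hp hp' hq hq' him him'.symm hlt).not_gt hlt'

lemma LeftOf.trans {B C D : Set ℂ} (hB : Convex ℝ B) (hC : Convex ℝ C) (hD : Convex ℝ D)
    (hBC : Disjoint B C) (hCD : Disjoint C D) (hCB : ∀ p ∈ C, ∃ q ∈ B, p.im ≤ q.im)
    (hCD' : ∀ p ∈ C, ∃ q ∈ D, p.im ≤ q.im) (h : LeftOf B C) (h' : LeftOf C D) : LeftOf B D := by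
  obtain ⟨p, hp, q, hq, hpq, hlt⟩ := h
  obtain ⟨q', hq', r', hr', hqr', hlt'⟩ := h'
  rcases le_total q.im q'.im with hle | hle
  · obtain ⟨x, hx, hqx⟩ := hCB q' hq'
    obtain ⟨z, hz, hzq⟩ := exists_mem_im_eq hB hp hx (hpq.le.trans hle) hqx
    exact ⟨z, hz, r', hr', hzq.trans hqr',
      (re_lt_re_of_disjoint hB hC hBC hp hz hq hq' hpq hzq hlt).trans hlt'⟩
  · obtain ⟨x, hx, hqx⟩ := hCD' q hq
    obtain ⟨z, hz, hzq⟩ := exists_mem_im_eq hD hr' hx (hqr'.symm.le.trans hle) hqx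
    exact ⟨p, hp, z, hz, hpq.trans hzq.symm,
      hlt.trans (re_lt_re_of_disjoint hC hD hCD hq' hq hr' hz hqr' hzq.symm hlt')⟩

lemma exists_forall_not_leftOf {ι : Type*} {C : ι → Set ℂ} (hC : ∀ i, Convex ℝ (C i))
    (T : Finset ι) (hT : T.Nonempty) (hdisj : (T : Set ι).PairwiseDisjoint C) :
    ∃ i ∈ T, ∀ j ∈ T, j ≠ i → ¬ LeftOf (C i) (C j) := by
  classical
  induction T using Finset.strongInduction with
  | H T ih =>
  -- Remove a member that starts lowest: the relation is transitive through such a member.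
  obtain ⟨s, hs, hmin⟩ := T.exists_min_image (fun i => lowerClosure (Complex.im '' C i)) hT
  have hlow : ∀ i ∈ T, ∀ p ∈ C s, ∃ q ∈ C i, p.im ≤ q.im := fun i hi p hp => by
    obtain ⟨_, ⟨q, hq, rfl⟩, hpq⟩ :=
      hmin i hi (subset_lowerClosure (mem_image_of_mem Complex.im hp))
    exact ⟨q, hq, hpq⟩
  rcases (T.erase s).eq_empty_or_nonempty with hempty | hne
  · refine ⟨s, hs, fun j hj hjs => absurd (Finset.mem_erase.2 ⟨hjs, hj⟩) ?_⟩
    exact hempty ▸ Finset.notMem_empty j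
  obtain ⟨m, hm, hmax⟩ := ih _ (Finset.erase_ssubset hs) hne
    (hdisj.subset (Finset.coe_subset.2 (T.erase_subset s)))
  obtain ⟨hms, hmT⟩ := Finset.mem_erase.1 hm
  by_cases hl : LeftOf (C m) (C s)
  · refine ⟨s, hs, fun j hj hjs hsj => ?_⟩
    rcases eq_or_ne j m with rfl | hjm
    · exact hl.asymm (hC j) (hC s) (hdisj hj hs hjs) hsj
    · exact hmax j (Finset.mem_erase.2 ⟨hjs, hj⟩) hjm
        (hl.trans (hC m) (hC s) (hC j) (hdisj hmT hs hms) (hdisj hs hj hjs.symm)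
          (hlow m hmT) (hlow j hj) hsj)
  · refine ⟨m, hmT, fun j hj hjm => ?_⟩
    rcases eq_or_ne j s with rfl | hjs
    · exact hl
    · exact hmax j (Finset.mem_erase.2 ⟨hjs, hj⟩) hjm

/-! ### Tilings up to the leftside boundary -/

/-- The tiles have disjoint interiors, and together with the leftside boundary they cover exactly
the polygon of `σ`. For a permutation that is not fully supported the polygon degenerates to a
path between certain vertices, so tilings in this weaker sense are the ones that can be studied by
removing one tile after another. -/
def IsQuasiTiling (θ : Fin n → ℝ) (σ : Perm (Fin n)) (T : Finset (Tile n)) : Prop :=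
  (⋃ t ∈ T, t.region θ) ∪ leftBoundary θ = polygon θ σ ∧
    (T : Set (Tile n)).PairwiseDisjoint fun t => interior (t.region θ)

lemma leftBoundary_subset_polygon [NeZero n] (hθ : IsDirections θ) (σ : Perm (Fin n)) :
    leftBoundary θ ⊆ polygon θ σ := by
  intro p hp
  obtain ⟨h0, h1, hre⟩ := (mem_path hθ 1 p).1 hp
  exact (mem_polygon hθ σ p).2 ⟨h0, h1, hre.ge, hre ▸ profile_one_le hθ σ h0 h1⟩

lemma IsRhombicTiling.isQuasiTiling [NeZero n] (hθ : IsDirections θ) {σ : Perm (Fin n)}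
    {T : Finset (Tile n)} (hT : IsRhombicTiling θ σ T) : IsQuasiTiling θ σ T :=
  ⟨by rw [hT.1, union_eq_left.2 (leftBoundary_subset_polygon hθ σ)],
    fun s hs t ht hst => hT.2 s hs t ht hst⟩

namespace IsQuasiTiling

variable {σ : Perm (Fin n)} {T : Finset (Tile n)}

lemma region_subset (hT : IsQuasiTiling θ σ T) {t : Tile n} (ht : t ∈ T) :
    t.region θ ⊆ polygon θ σ :=
  (subset_biUnion_of_mem (u := fun t : Tile n => t.region θ) (Finset.mem_coe.2 ht)).trans
    (subset_union_left.trans hT.1.subset)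

lemma mem_biUnion_of_lt [NeZero n] (hθ : IsDirections θ) (hT : IsQuasiTiling θ σ T) {p : ℂ}
    (hp : p ∈ polygon θ σ) (hlt : profile θ 1 (-p.im) < p.re) : p ∈ ⋃ t ∈ T, t.region θ :=
  (hT.1.superset hp).resolve_right fun h => hlt.ne' ((mem_path hθ 1 p).1 h).2.2

lemma eventually_mem_biUnion [NeZero n] (hθ : IsDirections θ) (hT : IsQuasiTiling θ σ T) {p : ℂ}
    (hp : p ∈ polygon θ σ) (hlt : p.re < profile θ σ (-p.im)) :
    ∀ᶠ δ : ℝ in 𝓝[>] 0, p + (δ : ℂ) ∈ ⋃ t ∈ T, t.region θ := by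
  obtain ⟨h0, h1, hl, -⟩ := (mem_polygon hθ σ p).1 hp
  filter_upwards [Ioo_mem_nhdsGT (sub_pos.2 hlt)] with δ hδ
  have him : (p + (δ : ℂ)).im = p.im := by simp
  have hre : (p + (δ : ℂ)).re = p.re + δ := by simp
  refine hT.mem_biUnion_of_lt hθ ((mem_polygon hθ σ _).2 ?_) ?_
  · rw [him, hre]
    exact ⟨h0, h1, by linarith [hδ.1], by linarith [hδ.2]⟩
  · rw [him, hre]
    linarith [hδ.1]

lemma one [NeZero n] (hθ : IsDirections θ) : IsQuasiTiling θ 1 (∅ : Finset (Tile n)) := by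
  refine ⟨?_, by simp⟩
  ext p
  simp only [Finset.notMem_empty, iUnion_false, iUnion_empty, empty_union, leftBoundary,
    mem_path hθ, mem_polygon hθ, le_antisymm_iff, and_comm]

open Classical in
lemma insert [NeZero n] (hθ : IsDirections θ) {k l : Fin n} (h : IsDescent σ k l)
    (hT : IsQuasiTiling θ (σ * swap k l) T) :
    IsQuasiTiling θ σ (Insert.insert (h.tile θ) T) := by
  refine ⟨?_, ?_⟩
  · rw [h.polygon_eq hθ, ← hT.1, Finset.set_biUnion_insert]
    ac_rfl
  · rw [Finset.coe_insert]
    exact hT.2.insert fun s hs _ => (h.disjoint_interior_region_tile hθ).mono_right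
      (interior_subset.trans (hT.region_subset hs))

open Classical in
lemma erase [NeZero n] (hθ : IsDirections θ) {k l : Fin n} (h : IsDescent σ k l)
    (hT : IsQuasiTiling θ σ T) (ht : h.tile θ ∈ T) :
    IsQuasiTiling θ (σ * swap k l) (T.erase (h.tile θ)) := by
  refine ⟨Subset.antisymm (union_subset (iUnion₂_subset fun s hs => ?_)
    (leftBoundary_subset_polygon hθ _)) fun p hp => ?_,
    hT.2.subset (Finset.coe_subset.2 (T.erase_subset _))⟩
  · obtain ⟨hst, hs⟩ := Finset.mem_erase.1 hs
    have hdisj : Disjoint (interior (s.region θ)) ((h.tile θ).region θ) := by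
      rw [← (h.tile θ).closure_interior_region hθ]
      exact (hT.2 hs ht hst).closure_right isOpen_interior
    rw [← s.closure_interior_region hθ]
    refine closure_minimal (fun p hp => ?_) (isClosed_polygon hθ _)
    have hp' := hT.region_subset hs (interior_subset hp)
    rw [h.polygon_eq hθ] at hp'
    exact hp'.resolve_right (disjoint_left.1 hdisj hp)
  · obtain ⟨h0, h1, hl, hr⟩ := (mem_polygon hθ _ p).1 hp
    rcases hl.eq_or_lt with heq | hlt
    · exact Or.inr ((mem_path hθ 1 p).2 ⟨h0, h1, heq.symm⟩)
    -- Points just to the left of `p` lie outside the removed tile.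
    have hleft : ∀ᶠ δ : ℝ in 𝓝[<] 0,
        p + (δ : ℂ) ∈ ⋃ s ∈ T.erase (h.tile θ), s.region θ := by
      filter_upwards [Ioo_mem_nhdsLT (sub_neg.2 hlt)] with δ hδ
      have him : (p + (δ : ℂ)).im = p.im := by simp
      have hre : (p + (δ : ℂ)).re = p.re + δ := by simp
      have hpoly : p + (δ : ℂ) ∈ polygon θ σ := by
        rw [mem_polygon hθ, him, hre]
        exact ⟨h0, h1, by linarith [hδ.1], by linarith [hδ.2, h.profile_le hθ (-p.im)]⟩
      obtain ⟨s, hs, hps⟩ := mem_iUnion₂.1 (hT.mem_biUnion_of_lt hθ hpoly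
        (by rw [him, hre]; linarith [hδ.1]))
      refine mem_iUnion₂.2 ⟨s, Finset.mem_erase.2 ⟨?_, hs⟩, hps⟩
      rintro rfl
      have hle := ((h.mem_region_tile hθ _).1 hps).2.1
      rw [him, hre] at hle
      linarith [hδ.2]
    exact Or.inl ((isClosed_biUnion_finset fun s _ => s.isClosed_region hθ).mem_of_tendsto
      (tendsto_add_ofReal p _) hleft)

lemma re_eq_profile [NeZero n] (hθ : IsDirections θ) (hT : IsQuasiTiling θ σ T) {t : Tile n}
    (ht : t ∈ T) (hmax : ∀ s ∈ T, s ≠ t → ¬ LeftOf (interior (t.region θ)) (interior (s.region θ)))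
    {p : ℂ} (hp : p ∈ t.region θ) (hlo : (t.coords hθ p).1 < drop θ t.lo)
    (hhi : 0 < (t.coords hθ p).2)
    (hright : (t.coords hθ p).1 = 0 ∨ (t.coords hθ p).2 = drop θ t.hi) :
    p.re = profile θ σ (-p.im) := by
  have hpoly := hT.region_subset ht hp
  refine ((mem_polygon hθ σ p).1 hpoly).2.2.2.eq_of_not_lt fun hlt => ?_
  obtain ⟨s, hs, hps, hfreq⟩ := exists_mem_of_eventually_mem_biUnion
    (fun s _ => s.isClosed_region hθ) (tendsto_add_ofReal p _)
    (hT.eventually_mem_biUnion hθ hpoly hlt)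
  obtain ⟨ε, hε, hε0⟩ := (hfreq.and_eventually self_mem_nhdsWithin).exists
  obtain ⟨δ, hδ, hpt⟩ := t.exists_sub_ofReal_mem_interior hθ hp hlo hhi
  obtain ⟨η, hη, hηε⟩ := exists_between (show 0 < ε from hε0)
  refine hmax s hs ?_ ⟨_, hpt, _, s.add_ofReal_mem_interior hθ hps hε hη hηε, by simp, ?_⟩
  · rintro rfl
    exact s.add_ofReal_notMem_region hθ hright hε0 hε
  · rw [Complex.add_re, Complex.add_re, Complex.ofReal_re, Complex.ofReal_re]
    linarith

end IsQuasiTiling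

/-! ### The rightmost tile -/

lemma pathVertex_eq_of_profile_eq (hθ : IsDirections θ) (σ : Perm (Fin n)) (k : Fin n) {v : ℂ}
    (h0 : 0 ≤ -v.im) (h1 : -v.im + drop θ (σ k) ≤ height θ)
    (h : ∀ u ∈ Ioo 0 (drop θ (σ k)), profile θ σ (-v.im + u) = v.re + slope θ (σ k) * u) :
    pathVertex θ σ k = v := by
  have hpos := drop_pos hθ (σ k)
  have hsub : Ioo (-v.im) (-v.im + drop θ (σ k)) ⊆
      Icc (depth θ σ k) (depth θ σ k + drop θ (σ k)) := by
    rintro d ⟨hd, hd'⟩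
    obtain ⟨i, hi, hi'⟩ := exists_depth_lt_le hθ σ (h0.trans_lt hd) (hd'.le.trans h1)
    obtain ⟨c, hc, hcd⟩ := exists_between (max_lt hd hi)
    obtain ⟨hvc, hic⟩ := max_lt_iff.1 hc
    -- On `[c, d]` the path follows its side `i`, which therefore has the slope of the side `k`.
    have hlin : ∀ x ∈ Ioo (-v.im) (-v.im + drop θ (σ k)),
        profile θ σ x = v.re + slope θ (σ k) * (x + v.im) := fun x hx => by
      have := h (x + v.im) ⟨by linarith [hx.1], by linarith [hx.2]⟩
      rwa [neg_add_cancel_comm_assoc] at this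
    have hcv := hlin c ⟨hvc, hcd.trans hd'⟩
    have hdv := hlin d ⟨hd, hd'⟩
    rw [profile_eq hθ σ hic.le (hcd.le.trans hi')] at hcv
    rw [profile_eq hθ σ hi.le hi'] at hdv
    have hslope : slope θ (σ i) = slope θ (σ k) :=
      mul_right_cancel₀ (sub_pos.2 hcd).ne' (by linear_combination hdv - hcv)
    obtain rfl : i = k := σ.injective ((slope_strictMono hθ).injective hslope)
    exact ⟨hi.le, hi'.trans_eq (depth_succ θ σ i)⟩
  have hdepth : depth θ σ k = -v.im := by
    have hcl := closure_minimal hsub isClosed_Icc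
    rw [closure_Ioo (lt_add_of_pos_right _ hpos).ne,
      Icc_subset_Icc_iff (le_add_of_nonneg_right hpos.le)] at hcl
    linarith [hcl.1, hcl.2]
  apply Complex.ext
  · have hhalf := h (drop θ (σ k) / 2) ⟨by linarith, by linarith⟩
    rw [← hdepth, profile_eq hθ σ (k := k) (by linarith) (by linarith [depth_succ θ σ k])] at hhalf
    linarith
  · rw [depth] at hdepth
    linarith

namespace IsQuasiTiling

variable {σ : Perm (Fin n)} {T : Finset (Tile n)}

lemma profile_eq_of_forall_not_leftOf [NeZero n] (hθ : IsDirections θ) (hT : IsQuasiTiling θ σ T)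
    {t : Tile n} (ht : t ∈ T)
    (hmax : ∀ s ∈ T, s ≠ t → ¬ LeftOf (interior (t.region θ)) (interior (s.region θ))) {a b : ℝ}
    (ha : a ∈ Ico 0 (drop θ t.lo)) (hb : b ∈ Ioc 0 (drop θ t.hi))
    (hab : a = 0 ∨ b = drop θ t.hi) :
    profile θ σ (-t.top.im + (a + b)) = t.top.re + slope θ t.lo * a + slope θ t.hi * b := by
  have hcoords : t.coords hθ ((t.coords hθ).symm (a, b)) = (a, b) :=
    (t.coords hθ).apply_symm_apply _
  have hmem : (t.coords hθ).symm (a, b) ∈ t.region θ := by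
    rw [t.region_eq_preimage_coords hθ, mem_preimage, hcoords]
    exact ⟨Ico_subset_Icc_self ha, Ioc_subset_Icc_self hb⟩
  have h := hT.re_eq_profile hθ ht hmax hmem (by rw [hcoords]; exact ha.2)
    (by rw [hcoords]; exact hb.1) (by rwa [hcoords])
  rw [Tile.coords_symm_re, Tile.coords_symm_im, neg_sub, sub_eq_neg_add] at h
  exact h.symm

lemma exists_isDescent_tile_eq [NeZero n] (hθ : IsDirections θ) (hT : IsQuasiTiling θ σ T)
    {t : Tile n} (ht : t ∈ T)
    (hmax : ∀ s ∈ T, s ≠ t → ¬ LeftOf (interior (t.region θ)) (interior (s.region θ))) :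
    ∃ k l, ∃ h : IsDescent σ k l, h.tile θ = t := by
  have hlo := drop_pos hθ t.lo
  have hhi := drop_pos hθ t.hi
  have htop := (mem_polygon hθ σ _).1 (hT.region_subset ht (t.top_mem_region θ))
  have hbot := (mem_polygon hθ σ _).1 (hT.region_subset ht (t.bot_mem_region θ))
  simp only [Complex.add_im, sideVec_im] at hbot
  obtain ⟨k, hk⟩ := σ.surjective t.hi
  obtain ⟨l, hl⟩ := σ.surjective t.lo
  have hkv : pathVertex θ σ k = t.top :=
    pathVertex_eq_of_profile_eq hθ σ k htop.1 (by rw [hk]; linarith [hbot.2.1]) fun u hu => by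
      rw [hk] at hu ⊢
      simpa using hT.profile_eq_of_forall_not_leftOf hθ ht hmax ⟨le_rfl, hlo⟩
        (Ioo_subset_Ioc_self hu) (Or.inl rfl)
  have hlv : pathVertex θ σ l = t.top + sideVec θ t.hi := by
    refine pathVertex_eq_of_profile_eq hθ σ l ?_ ?_ fun u hu => ?_
    · rw [Complex.add_im, sideVec_im]
      linarith [htop.1]
    · rw [Complex.add_im, sideVec_im, hl]
      linarith [hbot.2.1]
    · rw [hl] at hu ⊢
      have h := hT.profile_eq_of_forall_not_leftOf hθ ht hmax (Ioo_subset_Ico_self hu)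
        (right_mem_Ioc.2 hhi) (Or.inr rfl)
      rw [Complex.add_im, Complex.add_re, sideVec_im, sideVec_re hθ, add_right_comm, ← h]
      exact congrArg _ (by ring)
  have hkl : IsDescent σ k l := by
    refine ⟨(depth_strictMonoOn hθ σ).injOn l.2.le k.2 ?_, by rw [hk, hl]; exact t.lo_lt_hi⟩
    rw [depth, depth, hlv, pathVertex_succ, hkv, hk]
  exact ⟨k, l, hkl, by rcases t with ⟨top, lo, hi, hlt⟩; subst hk hl hkv; rfl⟩

lemma symm_hi_lt_symm_lo [NeZero n] (hθ : IsDirections θ) (hT : IsQuasiTiling θ σ T)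
    {t : Tile n} (ht : t ∈ T) : σ.symm t.hi < σ.symm t.lo := by
  classical
  induction σ using IsDescent.induction generalizing T with
  | step σ ih =>
  obtain ⟨s, hs, hmax⟩ := exists_forall_not_leftOf
    (fun s : Tile n => (s.convex_region θ).interior) T ⟨t, ht⟩ hT.2
  obtain ⟨k, l, h, rfl⟩ := hT.exists_isDescent_tile_eq hθ hs hmax
  rcases eq_or_ne t (h.tile θ) with rfl | hts
  · simpa [IsDescent.tile] using h.pos_lt
  · exact h.symm_lt_symm t.lo_lt_hi
      (ih k l h (hT.erase hθ h hs) (Finset.mem_erase.2 ⟨hts, ht⟩))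

end IsQuasiTiling

lemma exists_isQuasiTiling [NeZero n] (hθ : IsDirections θ) (σ : Perm (Fin n)) :
    ∃ T, IsQuasiTiling θ σ T := by
  classical
  induction σ using IsDescent.induction with
  | step σ ih =>
  by_cases hmono : Monotone σ
  · exact ⟨∅, (Equiv.Perm.monotone_iff σ).1 hmono ▸ IsQuasiTiling.one hθ⟩
  · obtain ⟨i, j, hij, hlt⟩ : ∃ i j, i ≤ j ∧ σ j < σ i := by simpa [Monotone] using hmono
    obtain ⟨k, l, h, -⟩ := exists_isDescent (hij.lt_of_ne (by rintro rfl; exact hlt.false)) hlt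
    obtain ⟨T, hT⟩ := ih k l h
    exact ⟨_, hT.insert hθ h⟩

/-! ### Tilings of a fully supported permutation -/

namespace IsQuasiTiling

variable {σ : Perm (Fin n)} {T : Finset (Tile n)}

lemma isRhombicTiling [NeZero n] (hθ : IsDirections θ) (hn : 2 ≤ n) (hσ : FullySupported σ)
    (hT : IsQuasiTiling θ σ T) : IsRhombicTiling θ σ T := by
  refine ⟨?_, fun s hs t ht hst => hT.2 hs ht hst⟩
  rw [← hT.1, eq_comm, union_eq_left]
  intro p hp
  obtain ⟨h0, h1, hre⟩ := (mem_path hθ 1 p).1 hp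
  obtain ⟨k, hk, hk'⟩ := exists_depth_le_le hθ 1 h0 h1
  have hclosed : IsClosed (⋃ t ∈ T, t.region θ) :=
    isClosed_biUnion_finset fun t _ => t.isClosed_region hθ
  have hcont : Continuous fun d : ℝ => (profile θ 1 d : ℂ) - d * Complex.I := by
    have := continuous_profile θ 1
    fun_prop
  have hsub : Ioo (depth θ 1 k) (depth θ 1 ((k : ℕ) + 1)) ⊆
      (fun d : ℝ => (profile θ 1 d : ℂ) - d * Complex.I) ⁻¹' ⋃ t ∈ T, t.region θ := by
    rintro d ⟨hd, hd'⟩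
    have hdim : -((profile θ 1 d : ℂ) - d * Complex.I).im = d := by simp
    have hdre : ((profile θ 1 d : ℂ) - d * Complex.I).re = profile θ 1 d := by simp
    have hlt := profile_one_lt hθ hn hσ hd hd'
    refine hclosed.mem_of_tendsto (tendsto_add_ofReal _ _) (hT.eventually_mem_biUnion hθ
      (leftBoundary_subset_polygon hθ σ ((mem_path hθ 1 _).2 ?_)) (by rwa [hdim, hdre]))
    rw [hdim, hdre]
    exact ⟨(depth_nonneg hθ 1 k).trans hd.le, hd'.le.trans (depth_le_height hθ 1 k.2), rfl⟩
  have hmem := closure_minimal hsub (hclosed.preimage hcont)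
  rw [closure_Ioo (depth_lt_depth_succ hθ 1 k).ne] at hmem
  have hp_eq : (profile θ 1 (-p.im) : ℂ) - ((-p.im : ℝ) : ℂ) * Complex.I = p := by
    apply Complex.ext <;> simp [hre]
  exact hp_eq ▸ hmem ⟨hk, hk'⟩

end IsQuasiTiling

lemma IsDescent.symm_mul_swap_lt {σ : Perm (Fin n)} {k l : Fin n} (h : IsDescent σ k l)
    {x y : Fin n} (hy : y ≠ σ k) (hyx : σ.symm y < σ.symm x) :
    (σ * swap k l).symm y < (σ * swap k l).symm x := by
  obtain ⟨a, rfl⟩ := σ.surjective x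
  obtain ⟨b, rfl⟩ := σ.surjective y
  have hkl : (l : ℕ) = k + 1 := h.val_eq
  have hb : b ≠ k := fun hb => hy (congrArg σ hb)
  rw [Equiv.symm_apply_apply, Equiv.symm_apply_apply] at hyx
  rw [symm_mul_swap_apply, symm_mul_swap_apply, swap_apply_def, swap_apply_def]
  split_ifs <;> omega

lemma eq_zero_of_pathVertex_eq_zero [NeZero n] (hθ : IsDirections θ) {σ : Perm (Fin n)}
    {k : Fin n} (h : pathVertex θ σ k = 0) : k = 0 := by
  refine Fin.ext ((depth_strictMonoOn hθ σ).injOn k.2.le (0 : Fin n).2.le ?_)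
  rw [Fin.val_zero, depth_zero, depth, h, Complex.zero_im, neg_zero]

lemma exists_isQuasiTiling_forall_hi_ne [NeZero n] (hθ : IsDirections θ) (σ : Perm (Fin n))
    {a b c : Fin n} (hbc : b < c) (hσ : σ.symm b < σ.symm a) :
    ∃ T, IsQuasiTiling θ σ T ∧ ∀ t ∈ T, t.top = 0 → t.lo = a → t.hi ≠ c := by
  classical
  induction σ using IsDescent.induction with
  | step σ ih =>
  by_cases hex : ∃ i j, i < j ∧ σ j < σ i ∧ b < σ i
  · obtain ⟨i, j, hij, hlt, hbi⟩ := hex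
    obtain ⟨k, l, h, hik⟩ := exists_isDescent hij hlt
    have hbk : b ≠ σ k := (hbi.trans_le hik).ne
    obtain ⟨T, hT, hne⟩ := ih k l h (h.symm_mul_swap_lt hbk hσ)
    refine ⟨_, hT.insert hθ h, fun t ht htop hlo => ?_⟩
    rcases Finset.mem_insert.1 ht with rfl | ht
    · obtain rfl : k = 0 := eq_zero_of_pathVertex_eq_zero hθ htop
      obtain rfl : σ l = a := hlo
      have hl : (l : ℕ) = 1 := h.val_eq
      rw [Equiv.symm_apply_apply, Fin.lt_def, hl, Nat.lt_one_iff] at hσ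
      exact absurd ((Equiv.symm_apply_eq σ).1 (Fin.ext hσ)) hbk
    · exact hne t ht htop hlo
  · push Not at hex
    obtain ⟨T, hT⟩ := exists_isQuasiTiling hθ σ
    refine ⟨T, hT, fun t ht _ _ hhi => ?_⟩
    have hle := hex _ _ (hT.symm_hi_lt_symm_lo hθ ht) (by simpa using t.lo_lt_hi)
    rw [Equiv.apply_symm_apply, hhi] at hle
    exact hbc.not_ge hle

/-! ### Tiles at the top vertex -/

namespace Tile

lemma eq_top_of_mem_region (hθ : IsDirections θ) (t : Tile n) {p : ℂ} (hp : p ∈ t.region θ)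
    (him : t.top.im ≤ p.im) : p = t.top := by
  rw [t.region_eq_preimage_coords hθ] at hp
  obtain ⟨⟨hlo, -⟩, hhi, -⟩ := hp
  have h := t.im_eq_coords hθ p
  have hlo0 : (t.coords hθ p).1 = 0 := by linarith
  have hhi0 : (t.coords hθ p).2 = 0 := by linarith
  apply Complex.ext
  · rw [t.re_eq_coords hθ, hlo0, hhi0, mul_zero, mul_zero, add_zero, add_zero]
  · rw [h, hlo0, hhi0, add_zero, sub_zero]

lemma lo_le_of_add_smul_sideVec_mem_region (hθ : IsDirections θ) (t : Tile n) {i : Fin n} {δ : ℝ}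
    (hδ : 0 < δ) (h : t.top + δ • sideVec θ i ∈ t.region θ) : t.lo ≤ i := by
  rw [t.region_eq_preimage_coords hθ] at h
  obtain ⟨⟨hlo, -⟩, hhi, -⟩ := h
  have him := t.im_eq_coords hθ (t.top + δ • sideVec θ i)
  have hre := t.re_eq_coords hθ (t.top + δ • sideVec θ i)
  generalize t.coords hθ (t.top + δ • sideVec θ i) = x at *
  rw [Complex.add_im, Complex.real_smul, Complex.im_ofReal_mul, sideVec_im] at him
  rw [Complex.add_re, Complex.real_smul, Complex.re_ofReal_mul, sideVec_re hθ] at hre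
  rw [← (slope_strictMono hθ).le_iff_le]
  have hsum : δ * drop θ i = x.1 + x.2 := by linarith
  refine le_of_mul_le_mul_right ?_ (mul_pos hδ (drop_pos hθ i))
  calc slope θ t.lo * (δ * drop θ i) = slope θ t.lo * x.1 + slope θ t.lo * x.2 := by
        rw [hsum, mul_add]
    _ ≤ slope θ t.lo * x.1 + slope θ t.hi * x.2 := by
        gcongr
        exact (slope_strictMono hθ t.lo_lt_hi).le
    _ = slope θ i * (δ * drop θ i) := by linarith

end Tile

lemma le_apply_zero_of_smul_sideVec_mem_polygon [NeZero n] (hθ : IsDirections θ)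
    {σ : Perm (Fin n)} {i : Fin n} {δ : ℝ} (hδ : 0 < δ) (hδ' : δ * drop θ i ≤ drop θ (σ 0))
    (h : δ • sideVec θ i ∈ polygon θ σ) : i ≤ σ 0 := by
  have hpos : 0 < δ * drop θ i := mul_pos hδ (drop_pos hθ i)
  have him : -(δ • sideVec θ i).im = δ * drop θ i := by
    rw [Complex.real_smul, Complex.im_ofReal_mul, sideVec_im, mul_neg, neg_neg]
  have hdepth : depth θ σ (0 : Fin n) = 0 := depth_zero θ σ
  have hle := ((mem_polygon hθ σ _).1 h).2.2.2
  rw [him, profile_eq hθ σ (k := 0) (hdepth.trans_le hpos.le)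
    (by rwa [depth_succ, hdepth, zero_add]),
    hdepth, Fin.val_zero, pathVertex_zero, Complex.zero_re, zero_add, sub_zero,
    Complex.real_smul, Complex.re_ofReal_mul, sideVec_re hθ, mul_left_comm] at hle
  exact (slope_strictMono hθ).le_iff_le.1 (le_of_mul_le_mul_right hle hpos)

lemma pathSide_zero [NeZero n] (θ : Fin n → ℝ) (σ : Perm (Fin n)) :
    pathSide θ σ 0 = segment ℝ 0 (sideVec θ (σ 0)) := by
  rw [pathSide, pathVertex_succ, Fin.val_zero, pathVertex_zero, zero_add]

lemma IsRhombicTiling.exists_top_eq_zero [NeZero n] (hθ : IsDirections θ) {σ : Perm (Fin n)}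
    {T : Finset (Tile n)} (hT : IsRhombicTiling θ σ T) :
    ∃ t ∈ T, t.top = 0 ∧ t.lo = 0 ∧ t.hi ≤ σ 0 := by
  have hside : ∀ᶠ δ : ℝ in 𝓝[>] 0, δ • sideVec θ 0 ∈ ⋃ t ∈ T, t.region θ := by
    filter_upwards [Ioc_mem_nhdsGT one_pos] with δ hδ
    refine hT.1.superset (leftBoundary_subset_polygon hθ σ (mem_iUnion.2 ⟨0, ?_⟩))
    rw [pathSide_zero, Perm.one_apply, segment_eq_image', sub_zero]
    exact ⟨δ, Ioc_subset_Icc_self hδ, zero_add _⟩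
  have hlim : Tendsto (fun δ : ℝ => δ • sideVec θ 0) (𝓝[>] 0) (𝓝 0) := by
    have h : Continuous fun δ : ℝ => δ • sideVec θ 0 := by fun_prop
    simpa using (h.tendsto 0).mono_left nhdsWithin_le_nhds
  obtain ⟨t, ht, h0, hfreq⟩ := exists_mem_of_eventually_mem_biUnion
    (fun t _ => t.isClosed_region hθ) hlim hside
  have hpoly : t.region θ ⊆ polygon θ σ := (hT.isQuasiTiling hθ).region_subset ht
  have htop : t.top = 0 := (t.eq_top_of_mem_region hθ h0
    (neg_nonneg.1 ((mem_polygon hθ σ _).1 (hpoly (t.top_mem_region θ))).1)).symm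
  refine ⟨t, ht, htop, ?_, ?_⟩
  · obtain ⟨δ, hδ, hδ0⟩ := (hfreq.and_eventually self_mem_nhdsWithin).exists
    exact (Fin.zero_le _).antisymm' (t.lo_le_of_add_smul_sideVec_mem_region hθ hδ0
      (by rwa [htop, zero_add]))
  · have hhi := drop_pos hθ t.hi
    obtain ⟨δ, hδ, hδ'⟩ := exists_between (lt_min one_pos (div_pos (drop_pos hθ (σ 0)) hhi))
    obtain ⟨hδ1, hδ2⟩ := lt_min_iff.1 hδ'
    refine le_apply_zero_of_smul_sideVec_mem_polygon hθ hδ ((lt_div_iff₀ hhi).1 hδ2).le (hpoly ?_)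
    exact ⟨0, by simp, δ, ⟨hδ.le, hδ1.le⟩, by simp [htop]⟩

lemma eq_left_of_mem_segment {p q z : ℂ} (hpq : q.im < p.im) (hz : z ∈ segment ℝ p q)
    (him : p.im ≤ z.im) : z = p := by
  rw [segment_eq_image'] at hz
  obtain ⟨t, ⟨ht, -⟩, rfl⟩ := hz
  rw [Complex.add_im, Complex.real_smul, Complex.im_ofReal_mul, Complex.sub_im] at him
  obtain rfl : t = 0 := ht.antisymm' (by nlinarith)
  simp only [zero_smul, add_zero]

lemma eq_and_eq_of_segment_eq_segment {p p' q q' : ℂ} (hp : p'.im < p.im) (hq : q'.im < q.im)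
    (h : segment ℝ p p' = segment ℝ q q') : p = q ∧ p' = q' := by
  obtain rfl : p = q := by
    rcases le_total p.im q.im with hle | hle
    · exact (eq_left_of_mem_segment hp (h ▸ left_mem_segment ℝ q q') hle).symm
    · exact eq_left_of_mem_segment hq (h ▸ left_mem_segment ℝ p p') hle
  refine ⟨rfl, (wbtw_swap_right_iff ℝ p).1 ⟨?_, ?_⟩⟩
  · exact mem_segment_iff_wbtw.1 (h ▸ right_mem_segment ℝ p p')
  · exact mem_segment_iff_wbtw.1 (h ▸ right_mem_segment ℝ p q')

lemma Tile.lo_or_hi_eq_of_mem_edges (hθ : IsDirections θ) {t : Tile n} {i : Fin n}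
    (h : segment ℝ 0 (sideVec θ i) ∈ t.edges θ) :
    (t.lo = i ∧ (t.top = 0 ∨ t.top + sideVec θ t.hi = 0)) ∨
      (t.hi = i ∧ (t.top = 0 ∨ t.top + sideVec θ t.lo = 0)) := by
  have label_eq_of_segment_eq : ∀ {q : ℂ} {j : Fin n},
      segment ℝ 0 (sideVec θ i) = segment ℝ q (q + sideVec θ j) → j = i ∧ q = 0 := fun {q j} h => by
    obtain ⟨rfl, hij⟩ := eq_and_eq_of_segment_eq_segment
      (by rw [sideVec_im]; exact neg_lt_zero.2 (drop_pos hθ i))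
      (by rw [Complex.add_im, sideVec_im]; linarith [drop_pos hθ j]) h
    rw [zero_add] at hij
    exact ⟨(sideVec_injective hθ hij).symm, rfl⟩
  rcases h with h | h | h | h
  · exact Or.inl ((label_eq_of_segment_eq h).imp_right Or.inl)
  · exact Or.inr ((label_eq_of_segment_eq h).imp_right Or.inl)
  · exact Or.inr ((label_eq_of_segment_eq h).imp_right Or.inr)
  · rw [add_right_comm] at h
    exact Or.inl ((label_eq_of_segment_eq h).imp_right Or.inr)

lemma isTopPerimeter_iff [NeZero n] (hθ : IsDirections θ) {w : Perm (Fin n)} (hw : w 0 ≠ 0)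
    {t : Tile n} : IsTopPerimeter θ w t ↔ t.top = 0 ∧ t.lo = 0 ∧ t.hi = w 0 := by
  rw [IsTopPerimeter, pathSide_zero, pathSide_zero, Perm.one_apply]
  constructor
  · rintro ⟨hl, hr⟩
    have hhi : t.hi ≠ 0 := (t.lo.zero_le.trans_lt t.lo_lt_hi).ne'
    obtain ⟨hlo, hl⟩ := (Tile.lo_or_hi_eq_of_mem_edges hθ hl).resolve_right fun h => hhi h.1
    obtain ⟨hhi, hr⟩ := (Tile.lo_or_hi_eq_of_mem_edges hθ hr).resolve_left fun h =>
      hw (h.1.symm.trans hlo)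
    refine ⟨hl.resolve_right fun hl => ?_, hlo, hhi⟩
    have htop := neg_lt_zero.2 (drop_pos hθ t.hi)
    rcases hr with hr | hr
    · rw [hr, zero_add] at hl
      rw [← sideVec_im, hl] at htop
      exact htop.false
    · exact t.lo_lt_hi.ne' (sideVec_injective hθ (add_left_cancel (hl.trans hr.symm)))
  · rintro ⟨htop, hlo, hhi⟩
    rw [Tile.edges, htop, hlo, hhi, zero_add, zero_add]
    exact ⟨Or.inl rfl, Or.inr (Or.inl rfl)⟩

/-! ### Patterns -/

lemma FullySupported.apply_zero_ne [NeZero n] (hn : 2 ≤ n) {w : Perm (Fin n)}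
    (hw : FullySupported w) : w 0 ≠ 0 := by
  intro h
  refine hw 1 le_rfl (by omega) ?_
  have hset : {i : Fin n | (i : ℕ) < 1} = {0} := by
    ext i
    rw [mem_singleton_iff, Fin.ext_iff, Fin.val_zero]
    exact Nat.lt_one_iff
  rw [hset, image_singleton, h]

lemma together321_zero_iff [NeZero n] {w : Perm (Fin n)} :
    Together321 w (w 0) 0 ↔ ∃ j < w.symm 0, w j < w 0 := by
  constructor
  · rintro ⟨i, j, k, ⟨hij, hjk, hkj, hji⟩, hw, h0⟩
    simp only [Finset.mem_insert, Finset.mem_singleton, EmbeddingLike.apply_eq_iff_eq] at hw h0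
    have hj : 0 < j := (Fin.zero_le i).trans_lt hij
    have hwj : 0 < w j := (Fin.zero_le _).trans_lt hkj
    obtain rfl : 0 = i := by simpa [hj.ne, (hj.trans hjk).ne] using hw
    have hk : 0 = w k := by simpa [hwj.ne, (hwj.trans hji).ne] using h0
    exact ⟨j, by rwa [hk, Equiv.symm_apply_apply], hji⟩
  · rintro ⟨j, hj, hlt⟩
    have hj0 : 0 < j := Fin.pos_iff_ne_zero.2 (by rintro rfl; exact hlt.false)
    have hwj : w j ≠ 0 := fun h => hj.ne ((Equiv.eq_symm_apply w).2 h)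
    refine ⟨0, j, w.symm 0, ⟨hj0, hj, ?_, hlt⟩, by simp, by simp⟩
    rw [Equiv.apply_symm_apply]
    exact Fin.pos_iff_ne_zero.2 hwj

lemma isLRMin_symm_zero [NeZero n] (w : Perm (Fin n)) : IsLRMin w (w.symm 0) := fun j hj => by
  rw [Equiv.apply_symm_apply, Fin.pos_iff_ne_zero]
  exact fun h => hj.ne ((Equiv.eq_symm_apply w).2 h)

lemma firstLRMinAfterFirstIs_zero_iff [NeZero n] {w : Perm (Fin n)} (hw : w 0 ≠ 0) :
    FirstLRMinAfterFirstIs w 0 ↔ ∀ j < w.symm 0, w 0 ≤ w j := by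
  constructor
  · rintro ⟨i, ⟨-, hleast⟩, hi⟩
    obtain rfl : i = w.symm 0 := (Equiv.eq_symm_apply w).2 hi
    by_contra! hlt
    obtain ⟨m, ⟨hm, hwm⟩, hmin⟩ :=
      exists_minimal_of_wellFoundedLT (fun j => j < w.symm 0 ∧ w j < w 0) hlt
    have hm0 : 0 < m := Fin.pos_iff_ne_zero.2 (by rintro rfl; exact hwm.false)
    refine (hleast ⟨hm0, fun j hj => ?_⟩).not_gt hm
    by_contra! hle
    exact hj.not_ge (hmin ⟨hj.trans hm, hle.trans_lt hwm⟩ hj.le)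
  · intro h
    refine ⟨w.symm 0, ⟨⟨?_, isLRMin_symm_zero w⟩, fun j ⟨hj0, hj⟩ => ?_⟩, w.apply_symm_apply 0⟩
    · rw [Fin.pos_iff_ne_zero, Ne, Equiv.symm_apply_eq]
      exact hw.symm
    · exact not_lt.1 fun hlt => (hj 0 hj0).not_ge (h j hlt)

lemma not_together321_iff [NeZero n] {w : Perm (Fin n)} (hw : w 0 ≠ 0) :
    ¬ Together321 w (w 0) 0 ↔ FirstLRMinAfterFirstIs w 0 := by
  rw [together321_zero_iff, firstLRMinAfterFirstIs_zero_iff hw]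
  push Not
  rfl

/-! ### Forced tiles at the top vertex -/

lemma isForcedTopPerimeter_of_not_together321 [NeZero n] (hθ : IsDirections θ) {w : Perm (Fin n)}
    (h : ¬ Together321 w (w 0) 0) (hw : 0 < w 0) : IsForcedTopPerimeter θ w ⟨0, 0, w 0, hw⟩ := by
  refine fun T hT => ⟨?_, (isTopPerimeter_iff hθ hw.ne').2 ⟨rfl, rfl, rfl⟩⟩
  obtain ⟨⟨top, lo, hi, hlt⟩, ht, rfl, rfl, hle⟩ := hT.exists_top_eq_zero hθ
  have hinv : w.symm hi < w.symm 0 := (hT.isQuasiTiling hθ).symm_hi_lt_symm_lo hθ ht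
  obtain rfl : hi = w 0 := hle.eq_of_not_lt fun hlt =>
    h (together321_zero_iff.2 ⟨w.symm hi, hinv, by rwa [Equiv.apply_symm_apply]⟩)
  exact ht

lemma not_isForcedTopPerimeter_of_together321 [NeZero n] (hθ : IsDirections θ) (hn : 2 ≤ n)
    {w : Perm (Fin n)} (hw : FullySupported w) (h : Together321 w (w 0) 0) (t : Tile n) :
    ¬ IsForcedTopPerimeter θ w t := by
  intro ht
  obtain ⟨j, hj, hlt⟩ := together321_zero_iff.1 h
  obtain ⟨T, hT, hne⟩ := exists_isQuasiTiling_forall_hi_ne hθ w (a := 0) hlt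
    (by rwa [Equiv.symm_apply_apply])
  obtain ⟨htT, htop⟩ := ht T (hT.isRhombicTiling hθ hn hw)
  obtain ⟨h0, hlo, hhi⟩ := (isTopPerimeter_iff hθ (hw.apply_zero_ne hn)).1 htop
  exact hne t htT h0 hlo hhi

lemma IsForcedTopPerimeter.labels_eq [NeZero n] (hθ : IsDirections θ) (hn : 2 ≤ n)
    {w : Perm (Fin n)} (hw : FullySupported w) {t : Tile n} (ht : IsForcedTopPerimeter θ w t) :
    t.labels = {0, w 0} := by
  obtain ⟨T, hT⟩ := exists_isQuasiTiling hθ w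
  obtain ⟨-, hlo, hhi⟩ := (isTopPerimeter_iff hθ (hw.apply_zero_ne hn)).1
    (ht T (hT.isRhombicTiling hθ hn hw)).2
  rw [Tile.labels, hlo, hhi]

end

end Elnitsky

theorem theorem4 (n : ℕ) [NeZero n] (hn : 2 ≤ n) (θ : Fin n → ℝ) (hθ : Elnitsky.IsDirections θ)
    (w : Equiv.Perm (Fin n)) (hw : Elnitsky.FullySupported w) :
    ((∃ t : Elnitsky.Tile n, Elnitsky.IsForcedTopPerimeter θ w t) ↔
        ¬ Elnitsky.Together321 w (w 0) 0) ∧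
      (∀ t : Elnitsky.Tile n, Elnitsky.IsForcedTopPerimeter θ w t → t.labels = {0, w 0}) ∧
      (¬ Elnitsky.Together321 w (w 0) 0 ↔ Elnitsky.FirstLRMinAfterFirstIs w 0) := by
  have h0 : w 0 ≠ 0 := hw.apply_zero_ne hn
  refine ⟨⟨?_, fun h => ?_⟩, fun t ht => ht.labels_eq hθ hn hw, Elnitsky.not_together321_iff h0⟩
  · rintro ⟨t, ht⟩ h
    exact Elnitsky.not_isForcedTopPerimeter_of_together321 hθ hn hw h t ht
  · exact ⟨_, Elnitsky.isForcedTopPerimeter_of_not_together321 hθ h (Fin.pos_iff_ne_zero.2 h0)⟩
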